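/- **Setting.** Let the state $x=[x_b]_{b}$ consist of finitely many blocks $x_b\in\mathbb R^{n_b}$, each with its own input delay $\tau_b\ge 0$, and let $\omega$ be a standard Brownian motion in $\mathbb R^{n_w}$. Consider the linear stochastic time-delay system on $[t_0,\infty)$, $t_0\ge 0$, $$dx=(A_c x+B_c u(t-\tau))\,dt+G_c\,d\omega,\qquad z(t)=\sum_b\big(C_b x_b(t)+D_b u(t-\tau_b)\big),$$ where $A_c=\mathrm{diag}(A_b)$, the block $b$ of $B_cu(t-\tau)$ is $B_bu(t-\tau_b)$, and $G_c$ is any constant matrix. (One block is the single-delay model. The MIMO model built from SISO systems $(i,j)$ has the pairs $b=(i,j)$ as its blocks, each driven by $u_j$ and contributing to $z_i$.) The initial state is arbitrary. The input is deterministic and piecewise constant, $u(t)=u_k$ for $t_k\le t<t_{k+1}$, where $t_k=t_0+kT_s$ and $T_s>0$. Write $\tau_b/T_s=m_b-v_b$ with $m_b\in\mathbb Z_{\ge0}$ and $0\le v_b<1$, and put $\bar m=\max_b m_b$, $u_{o,k}=[u_{k-\bar m};\dots;u_{k-1}]$, $\tilde u_k=[u_{o,k};u_k]$. For $1\le p\le\bar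 m+1$ let $E^p$ be the matrix with $E^p\tilde u_k=u_{k-(\bar m+1)+p}$, and $E^p=0$ for $p=\bar m+2$. Let $V=\mathrm{diag}(v_bI)$, let $B_{1c}$ and $B_{2c}$ have the blocks $B_bE^{\bar m+1-m_b}$ and $B_bE^{\bar m+2-m_b}$, and let $\bar B_{2c}=V(B_{2c}-B_{1c})$, $C_cx=\sum_bC_bx_b$ and $D_o=\sum_bD_bE^{\bar m+1-m_b}$. **Statement.** The system of differential equations on $[0,T_s]$ $$\dot A=A_cA,\quad \dot A_v=VA_cA_v,\quad \dot B_1=AB_{1c},\quad \dot B_2=A_v\bar B_{2c},\quad \dot R_{ww}=(AG_c)(AG_c)',$$ $$A(0)=I,\quad A_v(0)=I,\quad B_1(0)=0,\quad B_2(0)=0,\quad R_{ww}(0)=0,$$ has a solution, and for every solution, with $A=A(T_s)$, $B_o=B_1(T_s)+B_2(T_s)=[B_{o,1}\;B_{o,2}]$ and $R_{ww}=R_{ww}(T_s)$, where $B_{o,2}$ and $D_{o,2}$ denote the last $n_u$ columns of $B_o$ and of $D_o=[D_{o,1}\;D_{o,2}]$, the following holds. 1. $A$ and $B_o$ are the matrices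 of the deterministic case, $$A=e^{A_cT_s},\qquad B_o=\int_0^{T_s}e^{A_cs}ds\,B_{1c}+V\int_0^{T_s}e^{VA_cs}ds\,(B_{2c}-B_{1c}),$$ and every solution of the deterministic system ($G_c=0$) satisfies, with $\tilde x_k=[x(t_k);u_{o,k}]$, $$\tilde x_{k+1}=\tilde A\tilde x_k+\tilde Bu_k,\qquad \tilde A=\begin{bmatrix}A&B_{o,1}\\0&I_A\end{bmatrix},\quad \tilde B=\begin{bmatrix}B_{o,2}\\I_B\end{bmatrix},\qquad k\ge0,$$ where $I_A$ and $I_B$ are the shift matrices with $u_{o,k+1}=I_Au_{o,k}+I_Bu_k$. 2. The Itô integrals $$w_k=\int_{t_k}^{t_{k+1}}A(t_{k+1}-t)\,G_c\,d\omega(t),\qquad k\ge0,$$ exist and are independent and identically distributed, $w_k\sim N(0,R_{ww})$ with $\mathrm{Cov}(w_k)=R_{ww}$. For every solution of the stochastic system, almost surely for all $k\ge0$, $$\tilde x_{k+1}=\tilde A\tilde x_k+\tilde Bu_k+\begin{bmatrix}w_k\\0\end{bmatrix},\qquad z(t_k)=\tilde C\tilde x_k+\tilde Du_k,\qquad \tilde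 C=[C_c\;D_{o,1}],\quad \tilde D=D_{o,2}.$$ 3. The integrals $\int_{t_k}^{t_{k+1}}A(t-t_k)\,G_c\,d\omega(t)$, $k\ge0$, also exist and are independent with the law $N(0,R_{ww})$ and covariance $R_{ww}$. -/

import Mathlib

open MeasureTheory ProbabilityTheory Filter Topology Matrix
open scoped NNReal ENNReal

noncomputable section

namespace TimeDelay

/-! ### The continuous-time model -/

/-- Indices of the stacked state `x = [x_b]_b`, the block `b` having dimension `n b`. -/
abbrev StateIdx {ι : Type*} (n : ι → ℕ) : Type _ := Σ b : ι, Fin (n b)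

/-- Indices of an input vector `ũ` that is made of `M + 1` stacked inputs of dimension `nu`. -/
abbrev InputIdx (M nu : ℕ) : Type := Fin (M + 1) × Fin nu

/-- Data of a linear time-delay model with input `u ∈ ℝ^nu`, output `z ∈ ℝ^nz` and noise
`ω ∈ ℝ^nw`, made of blocks `b : ι`, each with its own input delay `τ b`:
`dx_b = (A_b x_b + B_b u(t - τ_b)) dt + (G dω)_b` and `z = ∑ b, (C_b x_b + D_b u(t - τ_b))`.
A model with a single delay has one block. A multi-input multi-output model built from
single-input single-output ones has the pairs `(i, j)` as blocks; `B_(i,j)` is then zero except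
for its column `j`, `C_(i,j)` except for its row `i`, and `D_(i,j)` except for its entry `i j`. -/
structure System {ι : Type*} (n : ι → ℕ) (nu nz nw : ℕ) where
  A : ∀ b, Matrix (Fin (n b)) (Fin (n b)) ℝ
  B : ∀ b, Matrix (Fin (n b)) (Fin nu) ℝ
  C : ∀ b, Matrix (Fin nz) (Fin (n b)) ℝ
  D : ι → Matrix (Fin nz) (Fin nu) ℝ
  G : Matrix (StateIdx n) (Fin nw) ℝ
  τ : ι → ℝ

/-- The piecewise constant input: `u(t) = u_k` for `t0 + k Ts ≤ t < t0 + (k + 1) Ts`. -/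
def holdInput {nu : ℕ} (t0 Ts : ℝ) (u : ℤ → Fin nu → ℝ) (t : ℝ) : Fin nu → ℝ :=
  u ⌊(t - t0) / Ts⌋

section Model

variable {ι : Type*} [DecidableEq ι] {n : ι → ℕ} {nu nz nw : ℕ}

/-- `A_c`, the block diagonal matrix of the `A_b`. -/
def System.Ac (S : System n nu nz nw) : Matrix (StateIdx n) (StateIdx n) ℝ :=
  Matrix.blockDiagonal' S.A

variable [Fintype ι]

/-- The right-hand side `A_c x + B_c u(t - τ)`, where the rows of `B_c u(t - τ)` that belong to
the block `b` are those of `B_b u(t - τ_b)`. -/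
def System.drift (S : System n nu nz nw) (u : ℝ → Fin nu → ℝ) (t : ℝ) (x : StateIdx n → ℝ) :
    StateIdx n → ℝ :=
  S.Ac *ᵥ x + fun r => (S.B r.1 *ᵥ u (t - S.τ r.1)) r.2

/-- The output `z(t) = ∑ b, (C_b x_b + D_b u(t - τ_b))` in the state `x`. -/
def System.output (S : System n nu nz nw) (u : ℝ → Fin nu → ℝ) (t : ℝ) (x : StateIdx n → ℝ) :
    Fin nz → ℝ :=
  ∑ b, (S.C b *ᵥ (fun i => x ⟨b, i⟩) + S.D b *ᵥ u (t - S.τ b))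

/-- `x` is a continuous solution of `dx = (A_c x + B_c u(t - τ)) dt + dg` on `[t0, ∞)`. -/
def System.IsPath (S : System n nu nz nw) (t0 : ℝ) (u : ℝ → Fin nu → ℝ)
    (g x : ℝ → StateIdx n → ℝ) : Prop :=
  ContinuousOn x (Set.Ici t0) ∧
    ∀ t, t0 ≤ t → x t = x t0 + (∫ s in t0..t, S.drift u s (x s)) + (g t - g t0)

/-- `x` solves the deterministic system `dx/dt = A_c x + B_c u(t - τ)` on `[t0, ∞)`. -/
def System.IsDeterministicSolution (S : System n nu nz nw) (t0 : ℝ) (u : ℝ → Fin nu → ℝ)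
    (x : ℝ → StateIdx n → ℝ) : Prop :=
  S.IsPath t0 u 0 x

variable {Ω : Type*} [MeasurableSpace Ω]

/-- The process `x` solves the stochastic system `dx = (A_c x + B_c u(t - τ)) dt + G_c dω` on
`[t0, ∞)`, where `ω` is the process `W`. -/
def System.IsStochasticSolution (S : System n nu nz nw) (W : Fin nw → ℝ≥0 → Ω → ℝ) (P : Measure Ω)
    (t0 : ℝ) (u : ℝ → Fin nu → ℝ) (x : ℝ → Ω → StateIdx n → ℝ) : Prop :=
  (∀ t, t0 ≤ t → AEMeasurable (x t) P) ∧
    ∀ᵐ ω ∂P, S.IsPath t0 u (fun t => S.G *ᵥ fun j => W j t.toNNReal ω) (fun t => x t ω)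

end Model

/-! ### Brownian motion and integrals of deterministic functions against it -/

section Wiener

variable {Ω : Type*} [MeasurableSpace Ω]

/-- Standard Brownian motion in `ℝ^nw`. -/
structure IsBrownian {nw : ℕ} (W : Fin nw → ℝ≥0 → Ω → ℝ) (P : Measure Ω) : Prop where
  isBrownianReal : ∀ j, IsBrownianReal (W j) P
  indep : iIndepFun (fun j ω t => W j t ω) P

/-- A step function on `(a, b]`, with the value `c i` on `(t i, t (i + 1)]` for `i < N`, where
`a = t 0 ≤ t 1 ≤ ⋯ ≤ t N = b`. -/
structure StepFun (a b : ℝ) where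
  N : ℕ
  t : ℕ → ℝ
  mono : Monotone t
  first : t 0 = a
  last : t N = b
  c : ℕ → ℝ

/-- The step function as a function. -/
def StepFun.val {a b : ℝ} (φ : StepFun a b) (s : ℝ) : ℝ :=
  ∑ i ∈ Finset.range φ.N, (Set.Ioc (φ.t i) (φ.t (i + 1))).indicator (fun _ => φ.c i) s

/-- The elementary integral `∑ i, c i (β (t (i + 1)) - β (t i))` of a step function. -/
def StepFun.integral {a b : ℝ} (φ : StepFun a b) (β : ℝ≥0 → Ω → ℝ) (ω : Ω) : ℝ :=
  ∑ i ∈ Finset.range φ.N,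
    φ.c i * (β (φ.t (i + 1)).toNNReal ω - β (φ.t i).toNNReal ω)

/-- `I` is (a version of) the Itô integral `∫_a^b f dβ` of the deterministic function
`f ∈ L²((a, b])`: the `L²(P)`-limit of the elementary integrals of step functions that converge
to `f` in `L²((a, b])`. -/
def IsItoIntegral (β : ℝ≥0 → Ω → ℝ) (P : Measure Ω) (a b : ℝ) (f : ℝ → ℝ) (I : Ω → ℝ) : Prop :=
  MemLp f 2 (volume.restrict (Set.Ioc a b)) ∧ MemLp I 2 P ∧
    ∃ φ : ℕ → StepFun a b,
      Tendsto (fun k => eLpNorm (fun s => (φ k).val s - f s) 2 (volume.restrict (Set.Ioc a b)))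
        atTop (𝓝 0) ∧
      Tendsto (fun k => eLpNorm (fun ω => (φ k).integral β ω - I ω) 2 P) atTop (𝓝 0)

/-- `I` is (a version of) `∫_a^b F(t) dω(t)` for a matrix-valued deterministic function `F`: its
`r`-th entry is `∑ j, ∫_a^b F_rj(t) dω_j(t)`. -/
def IsItoIntegralVec {nw : ℕ} {R : Type*} (W : Fin nw → ℝ≥0 → Ω → ℝ) (P : Measure Ω) (a b : ℝ)
    (F : ℝ → Matrix R (Fin nw) ℝ) (I : Ω → R → ℝ) : Prop :=
  ∃ J : R → Fin nw → Ω → ℝ,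
    (∀ r j, IsItoIntegral (W j) P a b (fun t => F t r j) (J r j)) ∧
      ∀ᵐ ω ∂P, ∀ r, I ω r = ∑ j, J r j ω

/-- The random vectors `w_k` are independent and each has the law `N(0, R)`, with `R` as its
covariance matrix. -/
def IsGaussianWhiteNoise {R : Type*} [Fintype R] [DecidableEq R] (P : Measure Ω)
    (Rww : Matrix R R ℝ) (w : ℕ → Ω → R → ℝ) : Prop :=
  iIndepFun w P ∧
    ∀ k, HasLaw (fun ω => WithLp.toLp 2 (w k ω)) (multivariateGaussian 0 Rww) P ∧
      ∀ r s, cov[fun ω => w k ω r, fun ω => w k ω s; P] = Rww r s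

end Wiener

/-! ### The discrete-time model -/

section Discrete

/-- `E^p`, which selects `u_{k - (M + 1) + p}` from `ũ_k = [u_{k-M}; …; u_k]`, `1 ≤ p ≤ M + 1`;
it is `0` for other `p`. -/
def selector (M nu p : ℕ) : Matrix (Fin nu) (InputIdx M nu) ℝ :=
  Matrix.of fun j q => if (q.1 : ℕ) + 1 = p ∧ q.2 = j then 1 else 0

/-- `u_{o,k} = [u_{k-M}; …; u_{k-1}]`. -/
def inputHistory (M : ℕ) {nu : ℕ} (u : ℤ → Fin nu → ℝ) (k : ℤ) : Fin M × Fin nu → ℝ :=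
  fun q => u (k - M + (q.1 : ℕ)) q.2

/-- The shift `I_A` in `u_{o,k+1} = I_A u_{o,k} + I_B u_k`. -/
def shiftA (M nu : ℕ) : Matrix (Fin M × Fin nu) (Fin M × Fin nu) ℝ :=
  Matrix.of fun q q' => if (q'.1 : ℕ) = q.1 + 1 ∧ q'.2 = q.2 then 1 else 0

/-- The matrix `I_B` in `u_{o,k+1} = I_A u_{o,k} + I_B u_k`. -/
def shiftB (M nu : ℕ) : Matrix (Fin M × Fin nu) (Fin nu) ℝ :=
  Matrix.of fun q j => if (q.1 : ℕ) + 1 = M ∧ q.2 = j then 1 else 0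

/-- The columns of `H` that multiply `u_{o,k}` in `H ũ_k`. -/
def histCols {R : Type*} {M nu : ℕ} (H : Matrix R (InputIdx M nu) ℝ) :
    Matrix R (Fin M × Fin nu) ℝ :=
  Matrix.of fun r q => H r (q.1.castSucc, q.2)

/-- The columns of `H` that multiply `u_k` in `H ũ_k`. -/
def lastCols {R : Type*} {M nu : ℕ} (H : Matrix R (InputIdx M nu) ℝ) : Matrix R (Fin nu) ℝ :=
  Matrix.of fun r j => H r (Fin.last M, j)

variable {ι : Type*} {n : ι → ℕ} {nu nz nw : ℕ}

/-- `Ã = [A, B_{o,1}; 0, I_A]`. -/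
def augA {M : ℕ} (A : Matrix (StateIdx n) (StateIdx n) ℝ)
    (Bo : Matrix (StateIdx n) (InputIdx M nu) ℝ) :
    Matrix (StateIdx n ⊕ Fin M × Fin nu) (StateIdx n ⊕ Fin M × Fin nu) ℝ :=
  Matrix.fromBlocks A (histCols Bo) 0 (shiftA M nu)

/-- `B̃ = [B_{o,2}; I_B]`. -/
def augB {M : ℕ} (Bo : Matrix (StateIdx n) (InputIdx M nu) ℝ) :
    Matrix (StateIdx n ⊕ Fin M × Fin nu) (Fin nu) ℝ :=
  Matrix.fromRows (lastCols Bo) (shiftB M nu)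

/-- `B_{1c}`, whose block `b` is `B_b E^p` where `E^p` selects `u_{k - m_b}`. -/
def System.B1c (S : System n nu nz nw) (M : ℕ) (m : ι → ℕ) :
    Matrix (StateIdx n) (InputIdx M nu) ℝ :=
  Matrix.of fun r q => (S.B r.1 * selector M nu (M + 1 - m r.1)) r.2 q

/-- `B_{2c}`, whose block `b` is `B_b E^p` where `E^p` selects `u_{k - m_b + 1}`. -/
def System.B2c (S : System n nu nz nw) (M : ℕ) (m : ι → ℕ) :
    Matrix (StateIdx n) (InputIdx M nu) ℝ :=
  Matrix.of fun r q => (S.B r.1 * selector M nu (M + 2 - m r.1)) r.2 q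

variable [DecidableEq ι]

/-- `V`, the diagonal matrix with the blocks `v_b I`. -/
def delayV (n : ι → ℕ) (v : ι → ℝ) : Matrix (StateIdx n) (StateIdx n) ℝ :=
  Matrix.diagonal fun r => v r.1

variable [Fintype ι]

/-- `D_o = ∑ b, D_b E^p`, where `E^p` selects `u_{k - m_b}`. -/
def System.Do (S : System n nu nz nw) (M : ℕ) (m : ι → ℕ) : Matrix (Fin nz) (InputIdx M nu) ℝ :=
  ∑ b, S.D b * selector M nu (M + 1 - m b)

/-- `C̃ = [C_c, D_{o,1}]`. -/
def System.augC (S : System n nu nz nw) (M : ℕ) (m : ι → ℕ) :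
    Matrix (Fin nz) (StateIdx n ⊕ Fin M × Fin nu) ℝ :=
  Matrix.fromCols (Matrix.of fun i r => S.C r.1 i r.2) (histCols (S.Do M m))

/-- `D̃ = D_{o,2}`. -/
def System.augD (S : System n nu nz nw) (M : ℕ) (m : ι → ℕ) : Matrix (Fin nz) (Fin nu) ℝ :=
  lastCols (S.Do M m)

/-- `B̄_{2c} = V (B_{2c} - B_{1c})`. -/
def System.B2bar (S : System n nu nz nw) (M : ℕ) (m : ι → ℕ) (v : ι → ℝ) :
    Matrix (StateIdx n) (InputIdx M nu) ℝ :=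
  delayV n v * (S.B2c M m - S.B1c M m)

/-- The entrywise integral `∫_0^t e^{s H} ds`. -/
def integralExp {R : Type*} [Fintype R] [DecidableEq R] (H : Matrix R R ℝ) (t : ℝ) :
    Matrix R R ℝ :=
  Matrix.of fun i j => ∫ s in (0 : ℝ)..t, NormedSpace.exp (s • H) i j

/-- The matrix `A(t) = e^{A_c t}` of the deterministic case. -/
def System.detA (S : System n nu nz nw) (t : ℝ) : Matrix (StateIdx n) (StateIdx n) ℝ :=
  NormedSpace.exp (t • S.Ac)

/-- The matrix `B_o(t) = B_1(t) + B_2(t)` of the deterministic case, where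
`B_1(t) = ∫_0^t e^{s A_c} ds B_{1c}` and `B_2(t) = V ∫_0^t e^{s V A_c} ds (B_{2c} - B_{1c})`. -/
def System.detBo (S : System n nu nz nw) (M : ℕ) (m : ι → ℕ) (v : ι → ℝ) (t : ℝ) :
    Matrix (StateIdx n) (InputIdx M nu) ℝ :=
  integralExp S.Ac t * S.B1c M m +
    delayV n v * integralExp (delayV n v * S.Ac) t * (S.B2c M m - S.B1c M m)

/-- `F` is differentiable on `[0, T]`, entry by entry, with the derivative `F'`. -/
def HasMatrixDerivOn {R Q : Type*} (T : ℝ) (F F' : ℝ → Matrix R Q ℝ) : Prop :=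
  ∀ t ∈ Set.Icc 0 T, ∀ i j, HasDerivWithinAt (fun s => F s i j) (F' t i j) (Set.Icc 0 T) t

/-- The system of matrix differential equations for `A`, `A_v`, `B_1`, `B_2` and `R_ww` on
`[0, T]`, with its initial conditions. -/
structure System.IsODESolution (S : System n nu nz nw) (M : ℕ) (m : ι → ℕ) (v : ι → ℝ) (T : ℝ)
    (A Av : ℝ → Matrix (StateIdx n) (StateIdx n) ℝ)
    (B1 B2 : ℝ → Matrix (StateIdx n) (InputIdx M nu) ℝ)
    (Rww : ℝ → Matrix (StateIdx n) (StateIdx n) ℝ) : Prop where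
  A_deriv : HasMatrixDerivOn T A fun t => S.Ac * A t
  A_zero : A 0 = 1
  Av_deriv : HasMatrixDerivOn T Av fun t => delayV n v * S.Ac * Av t
  Av_zero : Av 0 = 1
  B1_deriv : HasMatrixDerivOn T B1 fun t => A t * S.B1c M m
  B1_zero : B1 0 = 0
  B2_deriv : HasMatrixDerivOn T B2 fun t => Av t * S.B2bar M m v
  B2_zero : B2 0 = 0
  Rww_deriv : HasMatrixDerivOn T Rww fun t => (A t * S.G) * (A t * S.G)ᵀ
  Rww_zero : Rww 0 = 0

end Discrete

end TimeDelay

end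

/-! The matrix equations are linear and triangular, so they can be solved one after another: `A` and
`Av` are forced to be exponentials, and then `B1`, `B2` and `Rww` are integrals of known functions
(`HasMatrixDerivOn.eq_exp`, `HasMatrixDerivOn.eq_integral`). Since `V` is a scalar on each block, it
commutes with block diagonal matrices, which gives `B_o` its deterministic form.

Within one sampling interval a block sees its delayed input switch at most once, from `u_{k-m_b}` to
`u_{k-m_b+1}`, at the time `v_b Ts` before the end (`holdInput_eq_ite`). The old value acting over
the whole interval produces `B_1`; the jump acting over the last stretch produces, after rescaling
time by `v_b`, the term `B_2` (`integral_exp_sub_smul_mulVec_switch`).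

The noise is additive, so the stochastic equation can be solved path by path. With `g = G W`, the
function `x - (g - g(a))` satisfies an equation driven by ordinary functions, and variation of
constants leaves the noise term `g(b) - g(a) + ∫ e^{(b-s)A_c} A_c (g(s) - g(a)) ds`
(`System.IsPath.sample`). Integration by parts shows that this is a version of the Itô integral
`w_k` (`isItoIntegral_of_hasDerivAt`, `itoByParts_exp`), and such versions agree almost surely.

The law of the noise follows from the isometry for elementary integrals and from the closure of
Gaussian families under `L²` limits. All entries of all `w_k` are jointly Gaussian; integrals over
disjoint intervals are uncorrelated, hence independent. Reflecting or translating time carries each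
covariance to the integral over `[0, Ts]` that defines `Rww`, so both kernels have the same law. -/

noncomputable section

namespace TimeDelay

/-! ### Matrix exponentials and linear differential equations -/

section LinearODE

variable {R : Type*} [Fintype R] [DecidableEq R]

open scoped Matrix.Norms.Operator in
lemma hasDerivAt_exp_smul_apply (H : Matrix R R ℝ) (t : ℝ) (i j : R) :
    HasDerivAt (fun s : ℝ => NormedSpace.exp (s • H) i j) ((H * NormedSpace.exp (t • H)) i j) t := by
  have h := hasDerivAt_exp_smul_const' (𝕂 := ℝ) H t
  exact hasDerivAt_pi.1 (hasDerivAt_pi.1 h i) j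

open scoped Matrix.Norms.Operator in
lemma mul_exp_smul_comm (H : Matrix R R ℝ) (t : ℝ) :
    H * NormedSpace.exp (t • H) = NormedSpace.exp (t • H) * H :=
  ((Commute.refl H).smul_right t).exp_right

lemma hasDerivAt_exp_sub_smul_apply (H : Matrix R R ℝ) (b t : ℝ) (i j : R) :
    HasDerivAt (fun s : ℝ => NormedSpace.exp ((b - s) • H) i j)
      (-(NormedSpace.exp ((b - t) • H) * H) i j) t := by
  have h := (hasDerivAt_exp_smul_apply H (b - t) i j).comp t ((hasDerivAt_id t).const_sub b)
  rw [mul_exp_smul_comm] at h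
  simpa [Function.comp_def] using h

lemma continuous_exp_smul_apply (H : Matrix R R ℝ) (i j : R) :
    Continuous (fun s : ℝ => NormedSpace.exp (s • H) i j) :=
  continuous_iff_continuousAt.2 fun t => (hasDerivAt_exp_smul_apply H t i j).continuousAt

/-- Variation of constants for `dz/dt = H z + h`. -/
lemma variation_of_constants (H : Matrix R R ℝ) {a b : ℝ} (hab : a ≤ b) {z h : ℝ → R → ℝ}
    (hz : ContinuousOn z (Set.Icc a b))
    (hd : ∀ t ∈ Set.Ioo a b, ∀ i,
      HasDerivWithinAt (fun s => z s i) ((H *ᵥ z t) i + h t i) (Set.Ioi t) t)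
    (hi : ∀ i, IntervalIntegrable (fun s => h s i) volume a b) (i : R) :
    z b i = (NormedSpace.exp ((b - a) • H) *ᵥ z a) i +
      ∫ s in a..b, (NormedSpace.exp ((b - s) • H) *ᵥ h s) i := by
  have hE : ∀ j, Continuous fun s : ℝ => NormedSpace.exp ((b - s) • H) i j := fun j =>
    (continuous_exp_smul_apply H i j).comp (continuous_const.sub continuous_id)
  -- In the derivative of `e^{(b-s)H} z(s)` the two terms containing `H` cancel. Right derivatives
  -- suffice, which allows an `h` with jumps.
  have key := intervalIntegral.integral_eq_sub_of_hasDeriv_right_of_le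
    (f := fun s => (NormedSpace.exp ((b - s) • H) *ᵥ z s) i)
    (f' := fun s => (NormedSpace.exp ((b - s) • H) *ᵥ h s) i) hab ?_ ?_ ?_
  · rw [key]
    simp
  · simp only [Matrix.mulVec, dotProduct]
    exact continuousOn_finsetSum _ fun j _ => (hE j).continuousOn.mul
      ((continuous_apply j).comp_continuousOn hz)
  · intro t ht
    simp only [Matrix.mulVec, dotProduct]
    have h1 : ∀ j ∈ Finset.univ, HasDerivWithinAt
        (fun s => NormedSpace.exp ((b - s) • H) i j * z s j)
        (-(NormedSpace.exp ((b - t) • H) * H) i j * z t j +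
          NormedSpace.exp ((b - t) • H) i j * ((H *ᵥ z t) j + h t j)) (Set.Ioi t) t := fun j _ =>
      ((hasDerivAt_exp_sub_smul_apply H b t i j).hasDerivWithinAt).mul (hd t ht j)
    refine (HasDerivWithinAt.fun_sum h1).congr_deriv ?_
    have h2 : ∑ j, (NormedSpace.exp ((b - t) • H) * H) i j * z t j =
        ∑ j, NormedSpace.exp ((b - t) • H) i j * (H *ᵥ z t) j := by
      have := congrFun (Matrix.mulVec_mulVec (z t) (NormedSpace.exp ((b - t) • H)) H) i
      simpa [Matrix.mulVec, dotProduct] using this.symm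
    simp only [mul_add, neg_mul, Finset.sum_add_distrib, Finset.sum_neg_distrib, h2]
    ring
  · have e : (fun s => (NormedSpace.exp ((b - s) • H) *ᵥ h s) i) =
        ∑ j, fun s => NormedSpace.exp ((b - s) • H) i j * h s j := by
      funext s
      simp [Matrix.mulVec, dotProduct]
    rw [e]
    exact IntervalIntegrable.sum _ fun j _ => (hi j).continuousOn_mul (hE j).continuousOn

/-- `e^{tH}` is the only solution of `dF/dt = H F`, `F(0) = 1` on `[0, T]`. -/
lemma HasMatrixDerivOn.eq_exp {H : Matrix R R ℝ} {T : ℝ} {F : ℝ → Matrix R R ℝ}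
    (hF : HasMatrixDerivOn T F fun t => H * F t) (h0 : F 0 = 1) {t : ℝ}
    (ht : t ∈ Set.Icc 0 T) : F t = NormedSpace.exp (t • H) := by
  ext i j
  -- The equation is solved column by column, with no forcing.
  have := variation_of_constants (h := fun _ _ => 0) (z := fun s k => F s k j) H ht.1 ?_ ?_ ?_ i
  · rw [this]
    simp only [h0, sub_zero]
    simp [Matrix.mulVec, dotProduct, Matrix.one_apply]
  · refine continuousOn_pi.2 fun k s hs => ?_
    exact ((hF s ⟨hs.1, hs.2.trans ht.2⟩ k j).continuousWithinAt).mono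
      (Set.Icc_subset_Icc_right ht.2)
  · intro s hs k
    have hs' : s ∈ Set.Ioo 0 T := ⟨hs.1, hs.2.trans_le ht.2⟩
    have := ((hF s (Set.Ioo_subset_Icc_self hs') k j).hasDerivAt
      (Icc_mem_nhds hs'.1 hs'.2)).hasDerivWithinAt (s := Set.Ioi s)
    exact this.congr_deriv (by simp [Matrix.mulVec, dotProduct, Matrix.mul_apply])
  · exact fun _ => intervalIntegrable_const

lemma hasMatrixDerivOn_exp (H : Matrix R R ℝ) (T : ℝ) :
    HasMatrixDerivOn T (fun t => NormedSpace.exp (t • H)) fun t => H * NormedSpace.exp (t • H) :=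
  fun t _ i j => (hasDerivAt_exp_smul_apply H t i j).hasDerivWithinAt

end LinearODE

/-! ### Closed form of the sampling differential equations -/

section MatrixIntegral

variable {R Q : Type*}

/-- The entrywise integral of a continuous matrix-valued function. -/
lemma hasMatrixDerivOn_integral (T : ℝ) {F : ℝ → Matrix R Q ℝ}
    (hF : ∀ i j, Continuous fun s => F s i j) :
    HasMatrixDerivOn T (fun t => Matrix.of fun i j => ∫ s in (0 : ℝ)..t, F s i j) F :=
  fun t _ i j => ((hF i j).integral_hasStrictDerivAt 0 t).hasDerivAt.hasDerivWithinAt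

lemma HasMatrixDerivOn.eq_integral {T : ℝ} (hT : 0 ≤ T) {F F' : ℝ → Matrix R Q ℝ}
    (hF : HasMatrixDerivOn T F F') (h0 : F 0 = 0) {g : R → Q → ℝ → ℝ}
    (hg : ∀ i j, Continuous (g i j)) (hgF : ∀ t ∈ Set.Icc 0 T, ∀ i j, F' t i j = g i j t)
    (i : R) (j : Q) : F T i j = ∫ s in (0 : ℝ)..T, g i j s := by
  have := intervalIntegral.integral_eq_sub_of_hasDerivAt_of_le (f := fun s => F s i j)
    (f' := g i j) hT (fun s hs => (hF s hs i j).continuousWithinAt) (fun s hs => ?_)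
    ((hg i j).intervalIntegrable _ _)
  · rw [this, h0]
    simp
  · rw [← hgF s (Set.Ioo_subset_Icc_self hs)]
    exact (hF s (Set.Ioo_subset_Icc_self hs) i j).hasDerivAt (Icc_mem_nhds hs.1 hs.2)

end MatrixIntegral

section SamplingODE

variable {ι : Type*} [DecidableEq ι] [Fintype ι] {n : ι → ℕ} {nu nz nw : ℕ}

lemma System.delayV_mul_Ac (S : System n nu nz nw) (v : ι → ℝ) :
    delayV n v * S.Ac = Matrix.blockDiagonal' fun b => v b • S.A b := by
  ext ⟨b, i⟩ ⟨b', j⟩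
  by_cases h : b = b'
  · subst h
    simp [delayV, System.Ac]
  · simp [delayV, System.Ac, Matrix.blockDiagonal'_apply, h]

open scoped Matrix.Norms.Operator in
lemma exp_smul_blockDiagonal' (X : ∀ b, Matrix (Fin (n b)) (Fin (n b)) ℝ) (t : ℝ) :
    NormedSpace.exp (t • Matrix.blockDiagonal' X) =
      Matrix.blockDiagonal' fun b => NormedSpace.exp (t • X b) := by
  rw [← Matrix.blockDiagonal'_smul, Matrix.exp_blockDiagonal']
  congr 1
  ext b : 1
  exact Pi.coe_exp (t • X) b

lemma integralExp_blockDiagonal' (X : ∀ b, Matrix (Fin (n b)) (Fin (n b)) ℝ) (t : ℝ) :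
    integralExp (Matrix.blockDiagonal' X) t =
      Matrix.blockDiagonal' fun b => integralExp (X b) t := by
  ext ⟨b, i⟩ ⟨b', j⟩
  by_cases h : b = b'
  · subst h
    simp [integralExp, exp_smul_blockDiagonal']
  · simp [integralExp, exp_smul_blockDiagonal', Matrix.blockDiagonal'_apply, h]

/-- `V` is a scalar on each block. This moves `V` from the right of `∫ e^{sVA_c} ds`, where the
equation for `B2` puts it, to the left, where `System.detBo` has it. -/
lemma delayV_mul_blockDiagonal' (v : ι → ℝ) (X : ∀ b, Matrix (Fin (n b)) (Fin (n b)) ℝ) :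
    delayV n v * Matrix.blockDiagonal' X = Matrix.blockDiagonal' X * delayV n v := by
  ext ⟨b, i⟩ ⟨b', j⟩
  by_cases h : b = b'
  · subst h
    simp [delayV, mul_comm]
  · simp [delayV, Matrix.blockDiagonal'_apply, h]

lemma continuous_exp_smul_mul_apply {R Q : Type*} [Fintype R] [DecidableEq R] (H : Matrix R R ℝ)
    (K : Matrix R Q ℝ) (i : R) (j : Q) :
    Continuous fun s : ℝ => (NormedSpace.exp (s • H) * K) i j := by
  simp only [Matrix.mul_apply]
  exact continuous_finsetSum _ fun k _ => (continuous_exp_smul_apply H i k).mul continuous_const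

lemma integral_exp_smul_mul_apply {R Q : Type*} [Fintype R] [DecidableEq R] (H : Matrix R R ℝ)
    (K : Matrix R Q ℝ) (T : ℝ) (i : R) (j : Q) :
    ∫ s in (0 : ℝ)..T, (NormedSpace.exp (s • H) * K) i j = (integralExp H T * K) i j := by
  simp only [Matrix.mul_apply, integralExp, Matrix.of_apply]
  refine (intervalIntegral.integral_finsetSum fun k _ => Continuous.intervalIntegrable
    ((continuous_exp_smul_apply H i k).mul continuous_const) _ _).trans ?_
  exact Finset.sum_congr rfl fun k _ => intervalIntegral.integral_mul_const _ _

lemma continuous_noiseGram_apply (S : System n nu nz nw) (i j : StateIdx n) :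
    Continuous fun s : ℝ => ((NormedSpace.exp (s • S.Ac) * S.G) *
      (NormedSpace.exp (s • S.Ac) * S.G)ᵀ) i j := by
  simp only [Matrix.mul_apply (N := (_)ᵀ), Matrix.transpose_apply]
  exact continuous_finsetSum _ fun k _ => (continuous_exp_smul_mul_apply _ _ i k).mul
    (continuous_exp_smul_mul_apply _ _ j k)

theorem System.exists_isODESolution (S : System n nu nz nw) (M : ℕ) (m : ι → ℕ) (v : ι → ℝ)
    (T : ℝ) : ∃ A Av B1 B2 Rww, S.IsODESolution M m v T A Av B1 B2 Rww :=
  -- The fields determine the five functions by unification: two exponentials and three entrywise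
  -- integrals from `0`.
  ⟨_, _, _, _, _,
    { A_deriv := hasMatrixDerivOn_exp S.Ac T
      A_zero := by simp
      Av_deriv := hasMatrixDerivOn_exp (delayV n v * S.Ac) T
      Av_zero := by simp
      B1_deriv := hasMatrixDerivOn_integral T fun i j => continuous_exp_smul_mul_apply _ _ i j
      B1_zero := by ext; simp
      B2_deriv := hasMatrixDerivOn_integral T fun i j => continuous_exp_smul_mul_apply _ _ i j
      B2_zero := by ext; simp
      Rww_deriv := hasMatrixDerivOn_integral T fun i j => continuous_noiseGram_apply S i j
      Rww_zero := by ext; simp }⟩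

variable {S : System n nu nz nw} {M : ℕ} {m : ι → ℕ} {v : ι → ℝ} {T : ℝ}
  {A Av : ℝ → Matrix (StateIdx n) (StateIdx n) ℝ} {B1 B2 : ℝ → Matrix (StateIdx n) (InputIdx M nu) ℝ}
  {Rww : ℝ → Matrix (StateIdx n) (StateIdx n) ℝ}

lemma System.IsODESolution.A_eq (h : S.IsODESolution M m v T A Av B1 B2 Rww) {t : ℝ}
    (ht : t ∈ Set.Icc 0 T) : A t = NormedSpace.exp (t • S.Ac) :=
  h.A_deriv.eq_exp h.A_zero ht

lemma System.IsODESolution.Bo_eq (h : S.IsODESolution M m v T A Av B1 B2 Rww) (hT : 0 ≤ T) :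
    B1 T + B2 T = S.detBo M m v T := by
  have h1 : B1 T = integralExp S.Ac T * S.B1c M m := by
    ext i j
    rw [h.B1_deriv.eq_integral hT h.B1_zero
      (fun i j => continuous_exp_smul_mul_apply S.Ac (S.B1c M m) i j)
      (fun t ht i j => by rw [h.A_eq ht]), integral_exp_smul_mul_apply]
  have h2 : B2 T = integralExp (delayV n v * S.Ac) T * S.B2bar M m v := by
    ext i j
    rw [h.B2_deriv.eq_integral hT h.B2_zero
      (fun i j => continuous_exp_smul_mul_apply (delayV n v * S.Ac) (S.B2bar M m v) i j)
      (fun t ht i j => by rw [h.Av_deriv.eq_exp h.Av_zero ht]), integral_exp_smul_mul_apply]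
  rw [h1, h2, System.detBo, System.B2bar, System.delayV_mul_Ac, integralExp_blockDiagonal',
    delayV_mul_blockDiagonal', Matrix.mul_assoc]

lemma System.IsODESolution.Rww_apply (h : S.IsODESolution M m v T A Av B1 B2 Rww) (hT : 0 ≤ T)
    (i j : StateIdx n) :
    Rww T i j = ∫ s in (0 : ℝ)..T, ((NormedSpace.exp (s • S.Ac) * S.G) *
      (NormedSpace.exp (s • S.Ac) * S.G)ᵀ) i j :=
  h.Rww_deriv.eq_integral hT h.Rww_zero (continuous_noiseGram_apply S)
    (fun t ht i j => by rw [h.A_eq ht]) i j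

end SamplingODE

/-! ### Limits in `L²` and Gaussian laws -/

section L2Limits

variable {Ω : Type*} [MeasurableSpace Ω] {P : Measure Ω}

/-- Convergence in `L²`. -/
def TendstoL2 (P : Measure Ω) (X : ℕ → Ω → ℝ) (Y : Ω → ℝ) : Prop :=
  (∀ k, MemLp (X k) 2 P) ∧ MemLp Y 2 P ∧
    Tendsto (fun k => eLpNorm (fun ω => X k ω - Y ω) 2 P) atTop (𝓝 0)

lemma integral_mul_eq_inner {X Y : Ω → ℝ} (hX : MemLp X 2 P) (hY : MemLp Y 2 P) :
    ∫ ω, X ω * Y ω ∂P = inner ℝ (hX.toLp X) (hY.toLp Y) := by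
  rw [MeasureTheory.L2.inner_def]
  refine integral_congr_ae ?_
  filter_upwards [hX.coeFn_toLp, hY.coeFn_toLp] with ω h1 h2
  simp [h1, h2, mul_comm]

lemma TendstoL2.toLp {X : ℕ → Ω → ℝ} {Y : Ω → ℝ} (h : TendstoL2 P X Y) :
    Tendsto (fun k => (h.1 k).toLp (X k)) atTop (𝓝 (h.2.1.toLp Y)) :=
  (Lp.tendsto_Lp_iff_tendsto_eLpNorm'' X h.1 Y h.2.1).2 h.2.2

/-- The inner product of `L²` is jointly continuous. Means, variances, covariances and the isometry
all pass to the limit through this fact. -/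
lemma TendstoL2.integral_mul {X X' : ℕ → Ω → ℝ} {Y Y' : Ω → ℝ} (h : TendstoL2 P X Y)
    (h' : TendstoL2 P X' Y') :
    Tendsto (fun k => ∫ ω, X k ω * X' k ω ∂P) atTop (𝓝 (∫ ω, Y ω * Y' ω ∂P)) := by
  rw [integral_mul_eq_inner h.2.1 h'.2.1]
  simp_rw [fun k => integral_mul_eq_inner (h.1 k) (h'.1 k)]
  exact h.toLp.inner h'.toLp

lemma tendstoL2_const {Y : Ω → ℝ} (hY : MemLp Y 2 P) : TendstoL2 P (fun _ => Y) Y :=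
  ⟨fun _ => hY, hY, by simp⟩

lemma TendstoL2.integral [IsFiniteMeasure P] {X : ℕ → Ω → ℝ} {Y : Ω → ℝ} (h : TendstoL2 P X Y) :
    Tendsto (fun k => ∫ ω, X k ω ∂P) atTop (𝓝 (∫ ω, Y ω ∂P)) := by
  simpa using h.integral_mul (tendstoL2_const (memLp_const (1 : ℝ)))

lemma TendstoL2.variance [IsProbabilityMeasure P] {X : ℕ → Ω → ℝ} {Y : Ω → ℝ}
    (h : TendstoL2 P X Y) : Tendsto (fun k => Var[X k; P]) atTop (𝓝 Var[Y; P]) := by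
  rw [variance_eq_sub h.2.1]
  simp_rw [fun k => variance_eq_sub (h.1 k)]
  have h2 := (h.integral_mul h).sub (h.integral.pow 2)
  simpa [pow_two] using h2

lemma TendstoL2.add {X X' : ℕ → Ω → ℝ} {Y Y' : Ω → ℝ} (h : TendstoL2 P X Y)
    (h' : TendstoL2 P X' Y') : TendstoL2 P (fun k => X k + X' k) (Y + Y') := by
  refine ⟨fun k => (h.1 k).add (h'.1 k), h.2.1.add h'.2.1, ?_⟩
  refine tendsto_of_tendsto_of_tendsto_of_le_of_le tendsto_const_nhds
    (by simpa using h.2.2.add h'.2.2) (fun _ => zero_le) fun k => ?_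
  refine le_trans (le_of_eq ?_) (eLpNorm_add_le ((h.1 k).sub h.2.1).aestronglyMeasurable
    ((h'.1 k).sub h'.2.1).aestronglyMeasurable one_le_two)
  congr 1
  ext ω
  simp only [Pi.add_apply]
  ring

lemma TendstoL2.smul {X : ℕ → Ω → ℝ} {Y : Ω → ℝ} (h : TendstoL2 P X Y) (c : ℝ) :
    TendstoL2 P (fun k => c • X k) (c • Y) := by
  refine ⟨fun k => (h.1 k).const_smul c, h.2.1.const_smul c, ?_⟩
  have h1 := ENNReal.Tendsto.const_mul (a := ‖c‖ₑ) h.2.2 (Or.inr (by simp))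
  rw [mul_zero] at h1
  refine h1.congr fun k => ?_
  rw [← eLpNorm_const_smul]
  congr 1
  ext ω
  simp [mul_sub]

lemma TendstoL2.sub {X X' : ℕ → Ω → ℝ} {Y Y' : Ω → ℝ} (h : TendstoL2 P X Y)
    (h' : TendstoL2 P X' Y') : TendstoL2 P (fun k => X k - X' k) (Y - Y') := by
  have := h.add (h'.smul (-1))
  simpa [sub_eq_add_neg] using this

lemma TendstoL2.tendsto_eLpNorm {X : ℕ → Ω → ℝ} {Y : Ω → ℝ} (h : TendstoL2 P X Y) :
    Tendsto (fun k => eLpNorm (X k) 2 P) atTop (𝓝 (eLpNorm Y 2 P)) := by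
  have h1 := h.toLp.norm
  simp only [Lp.norm_toLp] at h1
  have h2 := ENNReal.tendsto_ofReal h1
  simpa [ENNReal.ofReal_toReal, (h.1 _).eLpNorm_ne_top, h.2.1.eLpNorm_ne_top] using h2

lemma TendstoL2.exists_subseq_ae {X : ℕ → Ω → ℝ} {Y : Ω → ℝ} (h : TendstoL2 P X Y) :
    ∃ ns : ℕ → ℕ, StrictMono ns ∧ ∀ᵐ ω ∂P, Tendsto (fun i => X (ns i) ω) atTop (𝓝 (Y ω)) :=
  (tendstoInMeasure_of_tendsto_eLpNorm two_ne_zero (fun k => (h.1 k).aestronglyMeasurable)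
    h.2.1.aestronglyMeasurable h.2.2).exists_seq_tendsto_ae

/-- An `L²` limit of real Gaussian random variables is Gaussian. -/
lemma TendstoL2.hasGaussianLaw [IsProbabilityMeasure P] {X : ℕ → Ω → ℝ} {Y : Ω → ℝ}
    (h : TendstoL2 P X Y) (hX : ∀ k, HasGaussianLaw (X k) P) : HasGaussianLaw Y P := by
  have hYm : AEMeasurable Y P := h.2.1.aestronglyMeasurable.aemeasurable
  obtain ⟨ns, hns, hae⟩ := h.exists_subseq_ae
  have hc : ∀ (t : ℝ) (Z : Ω → ℝ), AEMeasurable Z P →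
      charFun (P.map Z) t = ∫ ω, Complex.exp (t * Z ω * Complex.I) ∂P := fun t Z hZ => by
    rw [charFun_apply_real, integral_map hZ (by fun_prop)]
  have hG : ∀ (t : ℝ) (Z : Ω → ℝ), HasGaussianLaw Z P →
      ∫ ω, Complex.exp (t * Z ω * Complex.I) ∂P =
        Complex.exp (((t * ∫ ω, Z ω ∂P : ℝ) : ℂ) * Complex.I - ((t ^ 2 * Var[Z; P] : ℝ) : ℂ) / 2) := by
    intro t Z hZ
    rw [← hc t Z hZ.aemeasurable, hZ.map_eq_gaussianReal, charFun_gaussianReal]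
    congr 1
    push_cast
    rw [Real.coe_toNNReal _ (variance_nonneg _ _)]
    ring
  -- The characteristic functions converge along an almost surely convergent subsequence, by
  -- dominated convergence. Their Gaussian form survives because means and variances converge too;
  -- zero variance in the limit is allowed.
  have hlim : ∀ t : ℝ, ∫ ω, Complex.exp (t * Y ω * Complex.I) ∂P =
      Complex.exp (((t * ∫ ω, Y ω ∂P : ℝ) : ℂ) * Complex.I - ((t ^ 2 * Var[Y; P] : ℝ) : ℂ) / 2) := by
    intro t
    have h1 : Tendsto (fun i => ∫ ω, Complex.exp (t * X (ns i) ω * Complex.I) ∂P) atTop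
        (𝓝 (∫ ω, Complex.exp (t * Y ω * Complex.I) ∂P)) := by
      refine tendsto_integral_of_dominated_convergence (fun _ => 1) (fun i => ?_)
        (integrable_const _) (fun i => ae_of_all _ fun ω => ?_) ?_
      · have : AEMeasurable (X (ns i)) P := (h.1 _).aestronglyMeasurable.aemeasurable
        exact AEMeasurable.aestronglyMeasurable (by fun_prop)
      · rw [← Complex.ofReal_mul, Complex.norm_exp_ofReal_mul_I]
      · filter_upwards [hae] with ω hω
        have hcont : Continuous fun x : ℝ => Complex.exp (t * x * Complex.I) := by fun_prop
        exact (hcont.tendsto _).comp hω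
    refine tendsto_nhds_unique h1 ?_
    simp_rw [fun i => hG t _ (hX (ns i))]
    have h2 := h.integral.comp hns.tendsto_atTop
    have h3 := h.variance.comp hns.tendsto_atTop
    refine (Complex.continuous_exp.tendsto _).comp (Tendsto.sub (Tendsto.mul_const _ ?_)
      (Tendsto.div_const ?_ _))
    · exact (Complex.continuous_ofReal.tendsto _).comp (h2.const_mul t)
    · exact (Complex.continuous_ofReal.tendsto _).comp (h3.const_mul (t ^ 2))
  have hmap : P.map Y = gaussianReal (∫ ω, Y ω ∂P) (Var[Y; P]).toNNReal := by
    have := Measure.isProbabilityMeasure_map hYm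
    refine Measure.ext_of_charFun (funext fun t => ?_)
    rw [hc t Y hYm, hlim t, charFun_gaussianReal]
    congr 1
    push_cast
    rw [Real.coe_toNNReal _ (variance_nonneg _ _)]
    ring
  exact ⟨by rw [hmap]; infer_instance⟩

end L2Limits

/-! ### Gaussian processes through their linear spans -/

section GaussianSpan

variable {Ω T : Type*} [MeasurableSpace Ω] {P : Measure Ω}

lemma hasGaussianLaw_pi_of_dual {ι : Type*} [Finite ι] [IsProbabilityMeasure P] {X : Ω → ι → ℝ}
    (hm : AEMeasurable X P) (h : ∀ L : StrongDual ℝ (ι → ℝ), HasGaussianLaw (fun ω => L (X ω)) P) :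
    HasGaussianLaw X P := by
  have := Fintype.ofFinite ι
  refine ⟨⟨fun L => ?_⟩⟩
  have hL : Measurable L := L.continuous.measurable
  rw [AEMeasurable.map_map_of_aemeasurable hL.aemeasurable hm,
    integral_map hm hL.aestronglyMeasurable, variance_map hL.aemeasurable hm]
  exact (h L).map_eq_gaussianReal

/-- A linear functional of the vector is a linear combination of its coordinates, so it lies in the
span. -/
lemma hasGaussianLaw_pi_of_span {ι : Type*} [Fintype ι] [IsProbabilityMeasure P] {X : ι → Ω → ℝ}
    (h : ∀ Z ∈ Submodule.span ℝ (Set.range X), HasGaussianLaw Z P) :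
    HasGaussianLaw (fun ω i => X i ω) P := by
  classical
  refine hasGaussianLaw_pi_of_dual (aemeasurable_pi_lambda _ fun i =>
    (h _ (Submodule.subset_span ⟨i, rfl⟩)).aemeasurable) fun L => h _ ?_
  have e : (fun ω => L fun i => X i ω) = ∑ i, L (Pi.single i 1) • X i := by
    ext ω
    have : (fun i => X i ω) = ∑ i, X i ω • Pi.single i (1 : ℝ) := by
      ext j
      simp [Finset.sum_apply, Pi.single_apply]
    rw [this, map_sum]
    simp [mul_comm]
  rw [e]
  exact Submodule.sum_mem _ fun i _ => Submodule.smul_mem _ _ (Submodule.subset_span ⟨i, rfl⟩)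

lemma isGaussianProcess_of_span [IsProbabilityMeasure P] {X : T → Ω → ℝ}
    (h : ∀ Z ∈ Submodule.span ℝ (Set.range X), HasGaussianLaw Z P) : IsGaussianProcess X P where
  hasGaussianLaw I := hasGaussianLaw_pi_of_span (X := fun i : I => X i) fun Z hZ =>
    h Z (Submodule.span_mono (Set.range_comp_subset_range (fun i : I => (i : T)) X) hZ)

lemma _root_.ProbabilityTheory.IsGaussianProcess.hasGaussianLaw_of_mem_span {X : T → Ω → ℝ}
    (hX : IsGaussianProcess X P) {Z : Ω → ℝ} (hZ : Z ∈ Submodule.span ℝ (Set.range X)) :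
    HasGaussianLaw Z P := by
  classical
  obtain ⟨c, rfl⟩ := (Finsupp.mem_span_range_iff_exists_finsupp).1 hZ
  have h1 := (hX.hasGaussianLaw c.support).map_fun
    (∑ i : c.support, c i • ContinuousLinearMap.proj (R := ℝ) (φ := fun _ : c.support => ℝ) i)
  have e : (c.sum fun i a => a • X i) = fun ω =>
      (∑ i : c.support, c i • ContinuousLinearMap.proj (R := ℝ) (φ := fun _ : c.support => ℝ) i)
        (c.support.restrict (X · ω)) := by
    ext ω
    simp only [Finsupp.sum, Finset.sum_apply, Pi.smul_apply, _root_.sum_apply,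
      _root_.smul_apply, ContinuousLinearMap.proj_apply, Finset.restrict]
    exact (Finset.sum_coe_sort c.support fun i => c i • X i ω).symm
  rw [e]
  exact h1

lemma isGaussianProcess_of_tendstoL2 [IsProbabilityMeasure P] {X : ℕ → T → Ω → ℝ}
    {Y : T → Ω → ℝ} (hX : ∀ k, IsGaussianProcess (X k) P)
    (h : ∀ t, TendstoL2 P (fun k => X k t) (Y t)) : IsGaussianProcess Y P := by
  refine isGaussianProcess_of_span fun Z hZ => ?_
  -- A linear combination of the limits is the limit of the combinations with the same coefficients,
  -- and these are Gaussian.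
  suffices H : ∃ Z' : ℕ → Ω → ℝ, (∀ k, Z' k ∈ Submodule.span ℝ (Set.range (X k))) ∧
      TendstoL2 P Z' Z by
    obtain ⟨Z', h1, h2⟩ := H
    exact h2.hasGaussianLaw fun k => (hX k).hasGaussianLaw_of_mem_span (h1 k)
  induction hZ using Submodule.span_induction with
  | mem z hz =>
    obtain ⟨t, rfl⟩ := hz
    exact ⟨_, fun k => Submodule.subset_span ⟨t, rfl⟩, h t⟩
  | zero => exact ⟨fun _ => 0, fun k => Submodule.zero_mem _, tendstoL2_const MemLp.zero⟩
  | add x y _ _ hx hy =>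
    obtain ⟨a, ha, ha'⟩ := hx
    obtain ⟨b, hb, hb'⟩ := hy
    exact ⟨_, fun k => Submodule.add_mem _ (ha k) (hb k), ha'.add hb'⟩
  | smul c x _ hx =>
    obtain ⟨a, ha, ha'⟩ := hx
    exact ⟨_, fun k => Submodule.smul_mem _ c (ha k), ha'.smul c⟩

end GaussianSpan

/-! ### Elementary integrals and the Itô isometry -/

section StepFun

variable {a b c d : ℝ}

lemma StepFun.left_le (φ : StepFun a b) (i : ℕ) : a ≤ φ.t i :=
  φ.first.symm.le.trans (φ.mono (Nat.zero_le i))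

lemma StepFun.val_eq_indicator (φ : StepFun a b) : φ.val = (Set.Ioc a b).indicator φ.val := by
  funext s
  by_cases hs : s ∈ Set.Ioc a b
  · simp [hs]
  · rw [Set.indicator_of_notMem hs]
    refine Finset.sum_eq_zero fun i hi => Set.indicator_of_notMem (fun h => hs ?_) _
    have hN : φ.t (i + 1) ≤ b := (φ.mono (Finset.mem_range.1 hi)).trans φ.last.le
    exact ⟨(φ.left_le i).trans_lt h.1, h.2.trans hN⟩

lemma memLp_Ioc_indicator_const (s t c : ℝ) :
    MemLp ((Set.Ioc s t).indicator fun _ : ℝ => c) 2 volume :=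
  memLp_indicator_const 2 measurableSet_Ioc c (Or.inr (by simp))

lemma StepFun.memLp_val (φ : StepFun a b) : MemLp φ.val 2 volume :=
  memLp_finsetSum _ fun _ _ => memLp_Ioc_indicator_const _ _ _

end StepFun

section WienerIntegral

variable {Ω : Type*} [MeasurableSpace Ω] {P : Measure Ω} {a b c d : ℝ} {β γ : ℝ≥0 → Ω → ℝ}

lemma _root_.ProbabilityTheory.IsPreBrownianReal.memLp (hB : IsPreBrownianReal β P) (t : ℝ≥0) :
    MemLp (β t) 2 P :=
  (hB.isGaussianProcess.hasGaussianLaw_eval t).memLp_two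

lemma memLp_increment (hB : IsPreBrownianReal β P) (s t : ℝ≥0) :
    MemLp (fun ω => β t ω - β s ω) 2 P :=
  (hB.memLp t).sub (hB.memLp s)

lemma StepFun.memLp_integral (hB : IsPreBrownianReal β P) (φ : StepFun a b) :
    MemLp (φ.integral β) 2 P :=
  memLp_finsetSum _ fun _ _ => (memLp_increment hB _ _).const_mul _

lemma integral_increment (hB : IsPreBrownianReal β P) (s t : ℝ≥0) :
    ∫ ω, (β t ω - β s ω) ∂P = 0 := by
  rw [integral_sub (hB.integrable_eval t) (hB.integrable_eval s), hB.integral_eval,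
    hB.integral_eval, sub_zero]

/-- The covariance `min s t` of Brownian motion makes the covariance of two increments the length of
the intersection of their intervals. -/
lemma integral_increment_mul (hB : IsPreBrownianReal β P) {s t s' t' : ℝ} (hs : 0 ≤ s)
    (hst : s ≤ t) (hs' : 0 ≤ s') (hst' : s' ≤ t') :
    ∫ ω, (β t.toNNReal ω - β s.toNNReal ω) * (β t'.toNNReal ω - β s'.toNNReal ω) ∂P =
      ∫ x, (Set.Ioc s t).indicator (fun _ => (1 : ℝ)) x *
        (Set.Ioc s' t').indicator (fun _ => (1 : ℝ)) x := by
  have := hB.isGaussianProcess.isProbabilityMeasure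
  have h1 := covariance_eq_sub (memLp_increment hB s.toNNReal t.toNNReal)
    (memLp_increment hB s'.toNNReal t'.toNNReal)
  rw [integral_increment hB, zero_mul, sub_zero] at h1
  have h2 : ∀ x : ℝ, (Set.Ioc s t).indicator (fun _ => (1 : ℝ)) x *
        (Set.Ioc s' t').indicator (fun _ => (1 : ℝ)) x =
      (Set.Ioc (max s s') (min t t')).indicator (fun _ => (1 : ℝ)) x := fun x => by
    rw [← Set.Ioc_inter_Ioc, ← Set.inter_indicator_mul]
    simp
  simp_rw [h2]
  rw [integral_indicator measurableSet_Ioc]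
  refine h1.symm.trans ?_
  rw [covariance_fun_sub_fun_sub (hB.memLp _) (hB.memLp _) (hB.memLp _) (hB.memLp _)]
  simp only [hB.covariance_fun_eval, NNReal.coe_min, Real.coe_toNNReal _ hs,
    Real.coe_toNNReal _ hs', Real.coe_toNNReal _ (hs.trans hst),
    Real.coe_toNNReal _ (hs'.trans hst')]
  simp only [integral_const, MeasurableSet.univ, measureReal_restrict_apply, Set.univ_inter,
    Real.volume_real_Ioc, smul_eq_mul, mul_one]
  grind

/-- By bilinearity this reduces to pairs of increments. The polarised form, with two possibly
different intervals, also yields the correlations between distinct sampling periods. -/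
lemma StepFun.integral_mul_integral (hB : IsPreBrownianReal β P) (ha : 0 ≤ a) (hc : 0 ≤ c)
    (φ : StepFun a b) (ψ : StepFun c d) :
    ∫ ω, φ.integral β ω * ψ.integral β ω ∂P = ∫ x, φ.val x * ψ.val x := by
  have hv : ∀ (χ : ℝ) (s t x : ℝ), (Set.Ioc s t).indicator (fun _ => χ) x =
      χ * (Set.Ioc s t).indicator (fun _ => (1 : ℝ)) x := fun χ s t x => by
    rw [← Set.indicator_const_mul]
    simp
  simp only [StepFun.integral, StepFun.val, Finset.sum_mul_sum]
  rw [integral_finsetSum, integral_finsetSum]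
  · refine Finset.sum_congr rfl fun i _ => ?_
    rw [integral_finsetSum, integral_finsetSum]
    · refine Finset.sum_congr rfl fun j _ => ?_
      simp_rw [hv (φ.c i), hv (ψ.c j)]
      simp_rw [fun p q : ℝ => mul_mul_mul_comm (φ.c i) p (ψ.c j) q]
      rw [integral_const_mul, integral_const_mul, integral_increment_mul hB
        (ha.trans (φ.left_le i)) (φ.mono i.le_succ) (hc.trans (ψ.left_le j)) (ψ.mono j.le_succ)]
    · exact fun j _ => (memLp_Ioc_indicator_const _ _ _).integrable_mul
        (memLp_Ioc_indicator_const _ _ _)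
    · exact fun j _ => ((memLp_increment hB _ _).const_mul _).integrable_mul
        ((memLp_increment hB _ _).const_mul _)
  · exact fun i _ => integrable_finsetSum _ fun j _ =>
      (memLp_Ioc_indicator_const _ _ _).integrable_mul (memLp_Ioc_indicator_const _ _ _)
  · exact fun i _ => integrable_finsetSum _ fun j _ =>
      ((memLp_increment hB _ _).const_mul _).integrable_mul
        ((memLp_increment hB _ _).const_mul _)

lemma StepFun.integral_integral (hB : IsPreBrownianReal β P) (φ : StepFun a b) :
    ∫ ω, φ.integral β ω ∂P = 0 := by
  simp only [StepFun.integral]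
  have h : ∀ i ∈ Finset.range φ.N, Integrable (fun ω =>
      φ.c i * (β (φ.t (i + 1)).toNNReal ω - β (φ.t i).toNNReal ω)) P := fun i _ =>
    ((hB.integrable_eval _).sub (hB.integrable_eval _)).const_mul _
  rw [integral_finsetSum _ h]
  simp [integral_const_mul, integral_increment hB]

/-- The elementary integral as a function of the path. -/
lemma StepFun.measurable_path (φ : StepFun a b) : Measurable fun f : ℝ≥0 → ℝ =>
    ∑ i ∈ Finset.range φ.N, φ.c i * (f (φ.t (i + 1)).toNNReal - f (φ.t i).toNNReal) := by
  fun_prop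

/-- Elementary integrals are measurable functionals of the paths, so they inherit independence, and
their means vanish. -/
lemma StepFun.integral_mul_integral_of_indepFun (hB : IsPreBrownianReal β P)
    (hC : IsPreBrownianReal γ P) (hind : IndepFun (fun ω t => β t ω) (fun ω t => γ t ω) P)
    (φ : StepFun a b) (ψ : StepFun c d) :
    ∫ ω, φ.integral β ω * ψ.integral γ ω ∂P = 0 := by
  have h : IndepFun (φ.integral β) (ψ.integral γ) P :=
    hind.comp φ.measurable_path ψ.measurable_path
  rw [h.integral_fun_mul_eq_mul_integral (φ.memLp_integral hB).aestronglyMeasurable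
    (ψ.memLp_integral hC).aestronglyMeasurable, φ.integral_integral hB, zero_mul]

lemma eLpNorm_two_eq_of_integral_mul_self {Ω' : Type*} [MeasurableSpace Ω'] {P' : Measure Ω'}
    {X : Ω → ℝ} {Y : Ω' → ℝ} (hX : MemLp X 2 P) (hY : MemLp Y 2 P')
    (h : ∫ ω, X ω * X ω ∂P = ∫ ω, Y ω * Y ω ∂P') : eLpNorm X 2 P = eLpNorm Y 2 P' := by
  rw [hX.eLpNorm_eq_integral_rpow_norm two_ne_zero ENNReal.ofNat_ne_top,
    hY.eLpNorm_eq_integral_rpow_norm two_ne_zero ENNReal.ofNat_ne_top]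
  simp only [ENNReal.toReal_ofNat, Real.rpow_ofNat, Real.norm_eq_abs, sq_abs]
  simp only [pow_two, h]

lemma integral_sub_mul_sub {X Y : Ω → ℝ} (hX : MemLp X 2 P) (hY : MemLp Y 2 P) :
    ∫ ω, (X ω - Y ω) * (X ω - Y ω) ∂P =
      ∫ ω, X ω * X ω ∂P - 2 * ∫ ω, X ω * Y ω ∂P + ∫ ω, Y ω * Y ω ∂P := by
  have e : ∀ ω, (X ω - Y ω) * (X ω - Y ω) = X ω * X ω - 2 * (X ω * Y ω) + Y ω * Y ω :=
    fun ω => by ring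
  simp_rw [e]
  have hXX : Integrable (fun ω => X ω * X ω) P := hX.integrable_mul hX
  have hXY : Integrable (fun ω => X ω * Y ω) P := hX.integrable_mul hY
  have hYY : Integrable (fun ω => Y ω * Y ω) P := hY.integrable_mul hY
  have hD : Integrable (fun ω => X ω * X ω - 2 * (X ω * Y ω)) P := hXX.sub (hXY.const_mul 2)
  rw [integral_add hD hYY, integral_sub hXX (hXY.const_mul 2),
    integral_const_mul]

/-- The isometry for elementary integrals. -/
lemma StepFun.eLpNorm_integral_sub (hB : IsPreBrownianReal β P) (ha : 0 ≤ a)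
    (φ ψ : StepFun a b) :
    eLpNorm (fun ω => φ.integral β ω - ψ.integral β ω) 2 P =
      eLpNorm (fun s => φ.val s - ψ.val s) 2 volume := by
  -- The partitions may differ, so no common refinement is formed: the square is expanded and the
  -- polarised isometry is applied to each of the three terms.
  refine eLpNorm_two_eq_of_integral_mul_self ((φ.memLp_integral hB).sub (ψ.memLp_integral hB))
    (φ.memLp_val.sub ψ.memLp_val) ?_
  rw [integral_sub_mul_sub (φ.memLp_integral hB) (ψ.memLp_integral hB),
    integral_sub_mul_sub φ.memLp_val ψ.memLp_val, φ.integral_mul_integral hB ha ha,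
    φ.integral_mul_integral hB ha ha, ψ.integral_mul_integral hB ha ha]

lemma StepFun.eLpNorm_val_sub (φ : StepFun a b) (f : ℝ → ℝ) :
    eLpNorm (fun s => φ.val s - (Set.Ioc a b).indicator f s) 2 volume =
      eLpNorm (fun s => φ.val s - f s) 2 (volume.restrict (Set.Ioc a b)) := by
  rw [← eLpNorm_indicator_eq_eLpNorm_restrict measurableSet_Ioc]
  congr 1
  funext s
  rw [φ.val_eq_indicator]
  by_cases hs : s ∈ Set.Ioc a b <;> simp [hs]

/-- Extending the integrand by zero places integrals over different intervals in the same space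
`L²(ℝ)`, where their products can be compared. -/
lemma IsItoIntegral.exists_stepFun (hB : IsPreBrownianReal β P) {f : ℝ → ℝ} {I : Ω → ℝ}
    (h : IsItoIntegral β P a b f I) :
    ∃ φ : ℕ → StepFun a b, TendstoL2 P (fun k => (φ k).integral β) I ∧
      TendstoL2 volume (fun k => (φ k).val) ((Set.Ioc a b).indicator f) := by
  obtain ⟨hf, hI, φ, h1, h2⟩ := h
  refine ⟨φ, ⟨fun k => (φ k).memLp_integral hB, hI, h2⟩, fun k => (φ k).memLp_val,
    (memLp_indicator_iff_restrict measurableSet_Ioc).2 hf, ?_⟩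
  simpa only [StepFun.eLpNorm_val_sub] using h1

lemma IsItoIntegral.integral_mul (hB : IsPreBrownianReal β P) (ha : 0 ≤ a) (hc : 0 ≤ c)
    {f g : ℝ → ℝ} {I J : Ω → ℝ} (hI : IsItoIntegral β P a b f I)
    (hJ : IsItoIntegral β P c d g J) :
    ∫ ω, I ω * J ω ∂P =
      ∫ s, (Set.Ioc a b).indicator f s * (Set.Ioc c d).indicator g s := by
  obtain ⟨φ, h1, h2⟩ := hI.exists_stepFun hB
  obtain ⟨ψ, h3, h4⟩ := hJ.exists_stepFun hB
  refine tendsto_nhds_unique (h1.integral_mul h3) ?_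
  simp_rw [fun k => (φ k).integral_mul_integral hB ha hc (ψ k)]
  exact h2.integral_mul h4

lemma IsItoIntegral.integral_eq_zero (hB : IsPreBrownianReal β P) {f : ℝ → ℝ} {I : Ω → ℝ}
    (hI : IsItoIntegral β P a b f I) : ∫ ω, I ω ∂P = 0 := by
  have := hB.isGaussianProcess.isProbabilityMeasure
  obtain ⟨φ, h1, -⟩ := hI.exists_stepFun hB
  refine tendsto_nhds_unique h1.integral ?_
  simp [fun k => (φ k).integral_integral hB]

lemma IsItoIntegral.integral_mul_of_indepFun (hB : IsPreBrownianReal β P)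
    (hC : IsPreBrownianReal γ P) (hind : IndepFun (fun ω t => β t ω) (fun ω t => γ t ω) P)
    {f g : ℝ → ℝ} {I J : Ω → ℝ} (hI : IsItoIntegral β P a b f I)
    (hJ : IsItoIntegral γ P c d g J) : ∫ ω, I ω * J ω ∂P = 0 := by
  obtain ⟨φ, h1, -⟩ := hI.exists_stepFun hB
  obtain ⟨ψ, h3, -⟩ := hJ.exists_stepFun hC
  refine tendsto_nhds_unique (h1.integral_mul h3) ?_
  simp [fun k => (φ k).integral_mul_integral_of_indepFun hB hC hind (ψ k)]

/-- The Itô integral is unique almost surely. -/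
lemma IsItoIntegral.ae_eq (hB : IsPreBrownianReal β P) (ha : 0 ≤ a) {f : ℝ → ℝ} {I J : Ω → ℝ}
    (hI : IsItoIntegral β P a b f I) (hJ : IsItoIntegral β P a b f J) : I =ᵐ[P] J := by
  have h : ∫ ω, (I ω - J ω) * (I ω - J ω) ∂P = 0 := by
    rw [integral_sub_mul_sub hI.2.1 hJ.2.1, hI.integral_mul hB ha ha hI,
      hI.integral_mul hB ha ha hJ, hJ.integral_mul hB ha ha hJ]
    ring
  have hint : Integrable (fun ω => (I ω - J ω) * (I ω - J ω)) P :=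
    (hI.2.1.sub hJ.2.1).integrable_mul (hI.2.1.sub hJ.2.1)
  rw [integral_eq_zero_iff_of_nonneg (fun ω => mul_self_nonneg _) hint] at h
  filter_upwards [h] with ω hω
  exact sub_eq_zero.1 (mul_self_eq_zero.1 hω)

lemma IsItoIntegral.congr {f g : ℝ → ℝ} {I : Ω → ℝ} (hI : IsItoIntegral β P a b f I)
    (hfg : ∀ s ∈ Set.Ioc a b, f s = g s) : IsItoIntegral β P a b g I := by
  have hae : f =ᵐ[volume.restrict (Set.Ioc a b)] g :=
    (ae_restrict_iff' measurableSet_Ioc).2 (ae_of_all _ hfg)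
  obtain ⟨hf, hI, φ, h1, h2⟩ := hI
  refine ⟨hf.ae_eq hae, hI, φ, ?_, h2⟩
  refine h1.congr fun k => eLpNorm_congr_ae ?_
  filter_upwards [hae] with s hs
  rw [hs]

end WienerIntegral

/-! ### Riemann-Stieltjes sums along a continuous path -/

section RiemannSums

variable {a b : ℝ}

lemma StepFun.le_right (φ : StepFun a b) {i : ℕ} (hi : i ≤ φ.N) : φ.t i ≤ b :=
  (φ.mono hi).trans φ.last.le

lemma StepFun.val_of_mem (φ : StepFun a b) {i : ℕ} (hi : i < φ.N) {s : ℝ}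
    (hs : s ∈ Set.Ioc (φ.t i) (φ.t (i + 1))) : φ.val s = φ.c i := by
  rw [StepFun.val, Finset.sum_eq_single i]
  · rw [Set.indicator_of_mem hs]
  · intro j _ hj
    refine Set.indicator_of_notMem (fun h => ?_) _
    rcases lt_or_gt_of_ne hj with h' | h'
    · exact absurd (h.2.trans (φ.mono (Nat.succ_le_of_lt h'))) (not_le.2 hs.1)
    · exact absurd (hs.2.trans (φ.mono (Nat.succ_le_of_lt h'))) (not_le.2 h.1)
  · exact fun h => absurd (Finset.mem_range.2 hi) h

/-- The piece wanted ends at the first partition point that is at least `s`; taking the first one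
deals with repeated points. -/
lemma StepFun.exists_mem (φ : StepFun a b) {s : ℝ} (hs : s ∈ Set.Ioc a b) :
    ∃ i < φ.N, s ∈ Set.Ioc (φ.t i) (φ.t (i + 1)) := by
  have hex : ∃ k, s ≤ φ.t k := ⟨φ.N, hs.2.trans φ.last.ge⟩
  have h0 : Nat.find hex ≠ 0 := fun h => by
    have := Nat.find_spec hex
    rw [h, φ.first] at this
    exact absurd this (not_le.2 hs.1)
  obtain ⟨i, hi⟩ := Nat.exists_eq_succ_of_ne_zero h0
  have hle : Nat.find hex ≤ φ.N := Nat.find_min' hex (hs.2.trans φ.last.ge)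
  refine ⟨i, by omega, not_le.1 (Nat.find_min hex (by omega)), ?_⟩
  have := Nat.find_spec hex
  rwa [hi] at this

/-- The equidistant step function with the values of `f` at the left end points. -/
def uniformStep (hab : a ≤ b) (f : ℝ → ℝ) (N : ℕ) : StepFun a b where
  -- At least one piece, so that the mesh is defined for every `N`; the `min` below keeps all
  -- partition points in `[a, b]`.
  N := N + 1
  t i := a + (min i (N + 1) : ℕ) * ((b - a) / (N + 1))
  mono := fun i j hij => by
    have h1 : 0 ≤ (b - a) / ((N : ℝ) + 1) := div_nonneg (sub_nonneg.2 hab) (by positivity)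
    have h2 : ((min i (N + 1) : ℕ) : ℝ) ≤ (min j (N + 1) : ℕ) := by
      exact_mod_cast min_le_min_right _ hij
    have h3 := mul_le_mul_of_nonneg_right h2 h1
    linarith
  first := by simp
  last := by
    have : ((N : ℝ) + 1) ≠ 0 := by positivity
    simp only [min_self, Nat.cast_add, Nat.cast_one]
    field_simp
    ring
  c i := f (a + (min i (N + 1) : ℕ) * ((b - a) / (N + 1)))

lemma uniformStep_mesh (hab : a ≤ b) (f : ℝ → ℝ) (N : ℕ) {i : ℕ} (hi : i < N + 1) :
    (uniformStep hab f N).t (i + 1) - (uniformStep hab f N).t i = (b - a) / (N + 1) := by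
  simp only [uniformStep, min_eq_left (Nat.succ_le_of_lt hi), min_eq_left hi.le]
  push_cast
  ring

/-- The error of the Riemann-Stieltjes sums after summation by parts. -/
lemma StepFun.abs_sum_sub_le (φ : StepFun a b) {f f' B : ℝ → ℝ} {C ε δ : ℝ}
    (hc : ∀ i, φ.c i = f (φ.t i)) (hf : ∀ s, HasDerivAt f (f' s) s) (hf' : Continuous f')
    (hB : ContinuousOn B (Set.Icc a b)) (hC : ∀ s ∈ Set.Icc a b, |f' s| ≤ C)
    (hδ : ∀ i < φ.N, φ.t (i + 1) - φ.t i ≤ δ)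
    (hε : ∀ x ∈ Set.Icc a b, ∀ y ∈ Set.Icc a b, |x - y| ≤ δ → |B x - B y| ≤ ε) :
    |∑ i ∈ Finset.range φ.N, φ.c i * (B (φ.t (i + 1)) - B (φ.t i)) -
      (f b * (B b - B a) - ∫ s in a..b, f' s * (B s - B a))| ≤ C * ε * (b - a) := by
  have hmem : ∀ i ≤ φ.N, φ.t i ∈ Set.Icc a b := fun i hi => ⟨φ.left_le i, φ.le_right hi⟩
  have hsub : ∀ i < φ.N, Set.uIcc (φ.t i) (φ.t (i + 1)) ⊆ Set.Icc a b := fun i hi => by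
    rw [Set.uIcc_of_le (φ.mono i.le_succ)]
    exact Set.Icc_subset_Icc (φ.left_le i) (φ.le_right hi)
  have hint : ∀ i < φ.N, IntervalIntegrable (fun s => f' s * (B s - B a)) volume
      (φ.t i) (φ.t (i + 1)) := fun i hi =>
    (hf'.continuousOn.mul ((hB.mono (hsub i hi)).sub continuousOn_const)).intervalIntegrable
  have h1 : ∫ s in a..b, f' s * (B s - B a) =
      ∑ i ∈ Finset.range φ.N, ∫ s in φ.t i..φ.t (i + 1), f' s * (B s - B a) := by
    rw [intervalIntegral.sum_integral_adjacent_intervals hint, φ.first, φ.last]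
  have h2 : f b * (B b - B a) = ∑ i ∈ Finset.range φ.N,
      (f (φ.t (i + 1)) * (B (φ.t (i + 1)) - B a) - f (φ.t i) * (B (φ.t i) - B a)) := by
    rw [Finset.sum_range_sub fun i => f (φ.t i) * (B (φ.t i) - B a), φ.first, φ.last]
    ring
  have h3 : ∀ i < φ.N, (f (φ.t (i + 1)) - f (φ.t i)) * (B (φ.t (i + 1)) - B a) =
      ∫ s in φ.t i..φ.t (i + 1), f' s * (B (φ.t (i + 1)) - B a) := fun i _ => by
    rw [intervalIntegral.integral_mul_const,
      intervalIntegral.integral_eq_sub_of_hasDerivAt (fun s _ => hf s)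
        (hf'.intervalIntegrable _ _)]
  -- On each piece, `c i` times the increment of `B` is the increment of `f (B - B a)` minus the
  -- increment of `f` times `B (t (i + 1)) - B a`. Only the oscillation of `B` within a piece
  -- remains.
  have h4 : ∑ i ∈ Finset.range φ.N, φ.c i * (B (φ.t (i + 1)) - B (φ.t i)) -
      (f b * (B b - B a) - ∫ s in a..b, f' s * (B s - B a)) =
      ∑ i ∈ Finset.range φ.N,
        ∫ s in φ.t i..φ.t (i + 1), f' s * (B s - B (φ.t (i + 1))) := by
    rw [h1, h2, ← Finset.sum_sub_distrib, ← Finset.sum_sub_distrib]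
    refine Finset.sum_congr rfl fun i hi => ?_
    have hi := Finset.mem_range.1 hi
    have h5 : ∫ s in φ.t i..φ.t (i + 1), f' s * (B s - B (φ.t (i + 1))) =
        (∫ s in φ.t i..φ.t (i + 1), f' s * (B s - B a)) -
          ∫ s in φ.t i..φ.t (i + 1), f' s * (B (φ.t (i + 1)) - B a) := by
      have h6 : IntervalIntegrable (fun s => f' s * (B (φ.t (i + 1)) - B a)) volume
          (φ.t i) (φ.t (i + 1)) := (hf'.mul continuous_const).intervalIntegrable _ _
      rw [← intervalIntegral.integral_sub (hint i hi) h6]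
      congr 1
      ext s
      ring
    rw [h5, ← h3 i hi, hc i]
    ring
  rw [h4]
  calc _ ≤ ∑ i ∈ Finset.range φ.N, C * ε * (φ.t (i + 1) - φ.t i) := by
        refine (Finset.abs_sum_le_sum_abs _ _).trans (Finset.sum_le_sum fun i hi => ?_)
        have hi := Finset.mem_range.1 hi
        have hmono := φ.mono i.le_succ
        have := intervalIntegral.norm_integral_le_of_norm_le_const (a := φ.t i)
          (b := φ.t (i + 1)) (f := fun s => f' s * (B s - B (φ.t (i + 1)))) (C := C * ε)
          fun s hs => by
            rw [Set.uIoc_of_le hmono] at hs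
            have hs' : s ∈ Set.Icc a b := hsub i hi (Set.uIcc_of_le hmono ▸ ⟨hs.1.le, hs.2⟩)
            rw [Real.norm_eq_abs, abs_mul]
            refine mul_le_mul (hC s hs') (hε s hs' _ (hmem _ hi) ?_) (abs_nonneg _)
              ((abs_nonneg _).trans (hC s hs'))
            rw [abs_sub_comm, abs_of_nonneg (sub_nonneg.2 hs.2)]
            linarith [hδ i hi, hs.1]
        rwa [Real.norm_eq_abs, abs_of_nonneg (sub_nonneg.2 hmono)] at this
    _ = C * ε * (b - a) := by
        rw [← Finset.mul_sum, Finset.sum_range_sub, φ.first, φ.last]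

lemma tendsto_mesh (a b : ℝ) : Tendsto (fun N : ℕ => (b - a) / ((N : ℝ) + 1)) atTop (𝓝 0) :=
  tendsto_const_div_atTop_nhds_zero_nat (b - a) |>.comp (tendsto_add_atTop_nat 1) |>.congr
    fun N => by simp

/-- After summation by parts the error needs only the uniform continuity of `B`, not bounded
variation, so the result applies to Brownian paths. -/
lemma tendsto_uniformStep_sum (hab : a ≤ b) {f f' B : ℝ → ℝ} (hf : ∀ s, HasDerivAt f (f' s) s)
    (hf' : Continuous f') (hB : ContinuousOn B (Set.Icc a b)) :
    Tendsto (fun N => ∑ i ∈ Finset.range (uniformStep hab f N).N, (uniformStep hab f N).c i *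
        (B ((uniformStep hab f N).t (i + 1)) - B ((uniformStep hab f N).t i))) atTop
      (𝓝 (f b * (B b - B a) - ∫ s in a..b, f' s * (B s - B a))) := by
  obtain ⟨C, hC⟩ := isCompact_Icc.exists_bound_of_continuousOn (s := Set.Icc a b) hf'.continuousOn
  have hC0 : 0 ≤ C := (norm_nonneg _).trans (hC a ⟨le_rfl, hab⟩)
  have huc := isCompact_Icc.uniformContinuousOn_of_continuous hB
  rw [Metric.uniformContinuousOn_iff_le] at huc
  rw [Metric.tendsto_atTop']
  intro ε hε
  -- The `+ 1` keeps the denominator positive when `C = 0` or `a = b`; the total error is then at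
  -- most `ε / 2`.
  have hε' : 0 < ε / (2 * (C * (b - a) + 1)) := by
    have : 0 ≤ C * (b - a) := mul_nonneg hC0 (sub_nonneg.2 hab)
    positivity
  obtain ⟨δ, hδ, hδ'⟩ := huc _ hε'
  obtain ⟨N0, hN0⟩ := ((tendsto_mesh a b).eventually (ge_mem_nhds hδ)).exists_forall_of_atTop
  refine ⟨N0, fun N hN => ?_⟩
  rw [Real.dist_eq]
  refine lt_of_le_of_lt ((uniformStep hab f N).abs_sum_sub_le (fun _ => rfl) hf hf' hB hC
    (fun i hi => (uniformStep_mesh hab f N hi).le.trans (hN0 N hN.le))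
    (ε := ε / (2 * (C * (b - a) + 1))) fun x hx y hy hxy => ?_) ?_
  · exact hδ' x hx y hy hxy
  · have h0 : 0 ≤ C * (b - a) := mul_nonneg hC0 (sub_nonneg.2 hab)
    have h1 : C * (ε / (2 * (C * (b - a) + 1))) * (b - a) =
        ε / 2 * ((C * (b - a)) / (C * (b - a) + 1)) := by
      field_simp
    have h2 : (C * (b - a)) / (C * (b - a) + 1) ≤ 1 := by
      rw [div_le_one (by linarith)]
      linarith
    rw [h1]
    nlinarith

lemma tendsto_uniformStep_val (hab : a ≤ b) {f : ℝ → ℝ} (hf : Continuous f) :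
    Tendsto (fun N => eLpNorm (fun s => (uniformStep hab f N).val s - f s) 2
      (volume.restrict (Set.Ioc a b))) atTop (𝓝 0) := by
  have huc := isCompact_Icc.uniformContinuousOn_of_continuous (hf.continuousOn (s := Set.Icc a b))
  rw [Metric.uniformContinuousOn_iff_le] at huc
  -- `K` is the square root of the length of the interval: a uniform error `ε` costs at most `K ε`
  -- in `L²`.
  set K : ℝ≥0∞ := (volume.restrict (Set.Ioc a b)) Set.univ ^ (ENNReal.toReal 2)⁻¹
  have hK : K ≠ ∞ := ENNReal.rpow_ne_top_of_nonneg (by simp) (by simp)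
  have hlim : Tendsto (fun ε : ℝ => K * ENNReal.ofReal ε) (𝓝[>] 0) (𝓝 0) := by
    have h1 : Tendsto (fun ε : ℝ => ENNReal.ofReal ε) (𝓝[>] 0) (𝓝 0) := by
      simpa using (ENNReal.tendsto_ofReal tendsto_id).mono_left
        (nhdsWithin_le_nhds (a := (0 : ℝ)) (s := Set.Ioi 0))
    simpa using ENNReal.Tendsto.const_mul (a := K) h1 (Or.inr hK)
  rw [ENNReal.tendsto_nhds_zero]
  intro η hη
  obtain ⟨ε, hε1, hε⟩ := ((hlim.eventually (ge_mem_nhds hη)).and self_mem_nhdsWithin).exists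
  obtain ⟨δ, hδ, hδ'⟩ := huc ε hε
  filter_upwards [(tendsto_mesh a b).eventually (ge_mem_nhds hδ)] with N hN
  refine le_trans (eLpNorm_le_of_ae_bound (C := ε) ?_) hε1
  refine (ae_restrict_iff' measurableSet_Ioc).2 (ae_of_all _ fun s hs => ?_)
  obtain ⟨i, hi, hsi⟩ := (uniformStep hab f N).exists_mem hs
  rw [(uniformStep hab f N).val_of_mem hi hsi]
  refine hδ' _ ⟨(uniformStep hab f N).left_le i, (uniformStep hab f N).le_right hi.le⟩ s
    ⟨hs.1.le, hs.2⟩ ?_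
  rw [Real.dist_eq, abs_sub_comm, abs_of_pos (sub_pos.2 hsi.1)]
  have := uniformStep_mesh hab f N hi
  linarith [hsi.2]

end RiemannSums

/-! ### Existence of the Itô integral by integration by parts -/

section Existence

variable {Ω : Type*} [MeasurableSpace Ω] {P : Measure Ω} {a b : ℝ} {β : ℝ≥0 → Ω → ℝ}

/-- Integration by parts: the Itô integral of a continuously differentiable function. -/
theorem isItoIntegral_of_hasDerivAt (hB : IsBrownianReal β P) (ha : 0 ≤ a) (hab : a ≤ b)
    {f f' : ℝ → ℝ} (hf : ∀ s, HasDerivAt f (f' s) s) (hf' : Continuous f') :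
    IsItoIntegral β P a b f fun ω => f b * (β b.toNNReal ω - β a.toNNReal ω) -
      ∫ s in a..b, f' s * (β s.toNNReal ω - β a.toNNReal ω) := by
  have hfc : Continuous f := continuous_iff_continuousAt.2 fun s => (hf s).continuousAt
  have hpre := hB.toIsPreBrownianReal
  set Y : Ω → ℝ := fun ω => f b * (β b.toNNReal ω - β a.toNNReal ω) -
      ∫ s in a..b, f' s * (β s.toNNReal ω - β a.toNNReal ω)
  set φ := uniformStep hab f
  have hfm : MemLp f 2 (volume.restrict (Set.Ioc a b)) := by
    obtain ⟨C, hC⟩ := isCompact_Icc.exists_bound_of_continuousOn (hfc.continuousOn (s := Set.Icc a b))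
    exact MemLp.of_bound hfc.aestronglyMeasurable C ((ae_restrict_iff' measurableSet_Ioc).2
      (ae_of_all _ fun s hs => hC s ⟨hs.1.le, hs.2⟩))
  have hv : TendstoL2 volume (fun N => (φ N).val) ((Set.Ioc a b).indicator f) :=
    ⟨fun N => (φ N).memLp_val, (memLp_indicator_iff_restrict measurableSet_Ioc).2 hfm, by
      simpa only [StepFun.eLpNorm_val_sub] using tendsto_uniformStep_val hab hfc⟩
  have hae : ∀ᵐ ω ∂P, Tendsto (fun N => (φ N).integral β ω) atTop (𝓝 (Y ω)) := by
    filter_upwards [hB.cont] with ω hω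
    exact tendsto_uniformStep_sum hab (B := fun s => β s.toNNReal ω) hf hf'
      (hω.comp continuous_real_toNNReal).continuousOn
  -- Fatou's lemma bounds the distance to the pathwise limit `Y` by the limit inferior of the
  -- distances between elementary integrals. The isometry turns these into distances between step
  -- functions, which converge.
  have hle : ∀ N, eLpNorm (fun ω => (φ N).integral β ω - Y ω) 2 P ≤
      eLpNorm (fun s => (φ N).val s - (Set.Ioc a b).indicator f s) 2 volume := fun N => by
    have h1 := Lp.eLpNorm_lim_le_liminf_eLpNorm (p := 2) (μ := P)
      (f := fun K ω => (φ N).integral β ω - (φ K).integral β ω)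
      (fun K => (((φ N).memLp_integral hpre).sub ((φ K).memLp_integral hpre)).aestronglyMeasurable)
      (fun ω => (φ N).integral β ω - Y ω) (by
        filter_upwards [hae] with ω hω
        exact tendsto_const_nhds.sub hω)
    refine h1.trans (le_of_eq ?_)
    simp_rw [fun K => (φ N).eLpNorm_integral_sub hpre ha (φ K)]
    exact (((tendstoL2_const (φ N).memLp_val).sub hv).tendsto_eLpNorm).liminf_eq
  have hlim : Tendsto (fun N => eLpNorm (fun ω => (φ N).integral β ω - Y ω) 2 P) atTop (𝓝 0) :=
    tendsto_of_tendsto_of_tendsto_of_le_of_le tendsto_const_nhds hv.2.2 (fun _ => zero_le) hle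
  have hYm : AEStronglyMeasurable Y P := aestronglyMeasurable_of_tendsto_ae atTop
    (fun N => ((φ N).memLp_integral hpre).aestronglyMeasurable) hae
  -- Square integrability of `Y` comes from its finite distance to one elementary integral, without
  -- any estimate of the time integral in `Y`.
  have hD : MemLp (fun ω => (φ 0).integral β ω - Y ω) 2 P :=
    ⟨((φ 0).memLp_integral hpre).aestronglyMeasurable.sub hYm, (hle 0).trans_lt
      (((φ 0).memLp_val.sub hv.2.1).eLpNorm_lt_top)⟩
  have hY : MemLp Y 2 P := by
    have e : Y = (φ 0).integral β - fun ω => (φ 0).integral β ω - Y ω := by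
      funext ω
      simp
    rw [e]
    exact ((φ 0).memLp_integral hpre).sub hD
  exact ⟨hfm, hY, φ, tendsto_uniformStep_val hab hfc, hlim⟩

end Existence

/-! ### Multivariate Gaussian laws and white noise -/

section Multivariate

variable {Ω R : Type*} [MeasurableSpace Ω] [Fintype R] [DecidableEq R] {P : Measure Ω}

/-- A centered Gaussian vector has the law `N(0, Q)` where `Q` is its covariance matrix. -/
lemma hasLaw_multivariateGaussian [IsProbabilityMeasure P] {X : R → Ω → ℝ} {Q : Matrix R R ℝ}
    (hX : HasGaussianLaw (fun ω r => X r ω) P) (h0 : ∀ r, ∫ ω, X r ω ∂P = 0)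
    (hQ : ∀ r s, cov[X r, X s; P] = Q r s) :
    HasLaw (fun ω => WithLp.toLp 2 fun r => X r ω) (multivariateGaussian 0 Q) P := by
  have hL : HasGaussianLaw (fun ω => WithLp.toLp 2 fun r => X r ω) P := hX.toLp_pi 2
  have hmem : ∀ r, MemLp (X r) 2 P := fun r => (hX.eval r).memLp_two
  have hcov : ∀ x y : EuclideanSpace ℝ R,
      covarianceBilin (P.map fun ω => WithLp.toLp 2 fun r => X r ω) x y = x ⬝ᵥ Q *ᵥ y := fun x y => by
    rw [covarianceBilin_apply_pi hmem]
    simp only [hQ, dotProduct, Matrix.mulVec, Finset.mul_sum]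
    exact Finset.sum_congr rfl fun i _ => Finset.sum_congr rfl fun j _ => by ring
  -- The covariance formula for `multivariateGaussian` requires positive semidefiniteness; here it
  -- is inherited from the covariance form of `X`.
  have hpsd : Q.PosSemidef := by
    refine Matrix.PosSemidef.of_dotProduct_mulVec_nonneg ?_ fun x => ?_
    · ext r s
      simp only [Matrix.conjTranspose_apply, star_trivial]
      rw [← hQ, ← hQ, covariance_comm]
    · have h1 := hcov (WithLp.toLp 2 x) (WithLp.toLp 2 x)
      have h2 := isPosSemidef_covarianceBilin
        (μ := P.map fun ω => WithLp.toLp 2 fun r => X r ω) |>.nonneg (WithLp.toLp 2 x)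
      simp only [ContinuousLinearMap.toBilinForm_apply] at h2
      rw [h1] at h2
      simpa using h2
  refine ⟨hL.aemeasurable, ?_⟩
  have := hL.isGaussian_map
  apply IsGaussian.ext
  · rw [integral_id_multivariateGaussian', integral_map hL.aemeasurable (by fun_prop)]
    ext r
    have h1 := (EuclideanSpace.proj (𝕜 := ℝ) r).integral_comp_comm hL.integrable
    simp only [PiLp.proj_apply] at h1
    simp only [id_eq, ← h1, h0]
    simp
  · ext x y
    rw [hcov, covarianceBilin_multivariateGaussian hpsd]

end Multivariate

section WhiteNoise

variable {Ω : Type*} [MeasurableSpace Ω] {P : Measure Ω} {nw : ℕ} {W : Fin nw → ℝ≥0 → Ω → ℝ}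

/-- Independent Gaussian components are jointly Gaussian. A finite set of pairs is a projection of
all components at all times that occur in it. -/
lemma IsBrownian.isGaussianProcess (hW : IsBrownian W P) :
    IsGaussianProcess (fun p : Fin nw × ℝ≥0 => W p.1 p.2) P where
  hasGaussianLaw I := by
    classical
    set I' : Finset ℝ≥0 := I.image Prod.snd
    have h1 : ∀ j, HasGaussianLaw (fun ω => I'.restrict (W j · ω)) P := fun j =>
      (IsPreBrownianReal.isGaussianProcess (hW.isBrownianReal j).toIsPreBrownianReal).hasGaussianLaw _
    have h2 : iIndepFun (fun j ω => I'.restrict (W j · ω)) P :=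
      hW.indep.comp (fun _ f => I'.restrict f) fun _ => Finset.measurable_restrict I'
    have h3 := iIndepFun.hasGaussianLaw h1 h2
    let L : (Fin nw → I' → ℝ) →L[ℝ] (I → ℝ) := ContinuousLinearMap.pi fun p =>
      (ContinuousLinearMap.proj (R := ℝ) (φ := fun _ : I' => ℝ)
        ⟨p.1.2, Finset.mem_image_of_mem Prod.snd p.2⟩).comp
        (ContinuousLinearMap.proj (R := ℝ) (φ := fun _ : Fin nw => I' → ℝ) p.1.1)
    exact h3.map_fun L

/-- Elementary integrals lie in the span of the values of `W`, and `L²` limits preserve joint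
Gaussianity. Component, interval and integrand may vary with the index, as needed to treat all
periods together. -/
lemma IsBrownian.isGaussianProcess_ito [IsProbabilityMeasure P] (hW : IsBrownian W P) {T : Type*}
    {q : T → Fin nw} {a b : T → ℝ} {f : T → ℝ → ℝ} {J : T → Ω → ℝ}
    (hJ : ∀ t, IsItoIntegral (W (q t)) P (a t) (b t) (f t) (J t)) : IsGaussianProcess J P := by
  choose φ hφ _ using fun t => (hJ t).exists_stepFun (hW.isBrownianReal (q t)).toIsPreBrownianReal
  refine isGaussianProcess_of_tendstoL2 (X := fun k t => (φ t k).integral (W (q t)))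
    (fun k => isGaussianProcess_of_span fun Z hZ =>
      hW.isGaussianProcess.hasGaussianLaw_of_mem_span ?_) hφ
  refine Submodule.span_le.2 ?_ hZ
  rintro _ ⟨t, rfl⟩
  have e : (φ t k).integral (W (q t)) = ∑ i ∈ Finset.range (φ t k).N, (φ t k).c i •
      (W (q t) ((φ t k).t (i + 1)).toNNReal - W (q t) ((φ t k).t i).toNNReal) := by
    ext ω
    simp [StepFun.integral]
  dsimp only
  rw [e]
  exact Submodule.sum_mem _ fun i _ => Submodule.smul_mem _ _ (Submodule.sub_mem _
    (Submodule.subset_span ⟨(q t, _), rfl⟩) (Submodule.subset_span ⟨(q t, _), rfl⟩))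

/-- Integrals over consecutive intervals against a standard Brownian motion are independent
Gaussian vectors. -/
theorem IsBrownian.isGaussianWhiteNoise [IsProbabilityMeasure P] (hW : IsBrownian W P)
    {R : Type*} [Fintype R] [DecidableEq R] {t : ℕ → ℝ} (ht : Monotone t) (h0 : 0 ≤ t 0)
    {F : ℕ → ℝ → Matrix R (Fin nw) ℝ} {w : ℕ → Ω → R → ℝ}
    (hw : ∀ k, IsItoIntegralVec W P (t k) (t (k + 1)) (F k) (w k)) {Q : Matrix R R ℝ}
    (hQ : ∀ k r s, ∑ j, ∫ x in t k..t (k + 1), F k x r j * F k x s j = Q r s) :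
    IsGaussianWhiteNoise P Q w := by
  choose J hJ hae using hw
  have hpre : ∀ j, IsPreBrownianReal (W j) P := fun j => (hW.isBrownianReal j).toIsPreBrownianReal
  have htk : ∀ k, 0 ≤ t k := fun k => h0.trans (ht (Nat.zero_le k))
  have hw' : ∀ k r, (fun ω => w k ω r) =ᵐ[P] ∑ j, J k r j := fun k r => by
    filter_upwards [hae k] with ω hω
    simp [hω r]
  have hJmem : ∀ k r j, MemLp (J k r j) 2 P := fun k r j => (hJ k r j).2.1
  have hSmem : ∀ k r, MemLp (∑ j, J k r j) 2 P := fun k r => memLp_finsetSum' _ fun j _ => hJmem k r j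
  have hmean : ∀ k r, ∫ ω, (∑ j, J k r j) ω ∂P = 0 := fun k r => by
    simp only [Finset.sum_apply]
    rw [integral_finsetSum _ fun j _ => (hJmem k r j).integrable one_le_two]
    exact Finset.sum_eq_zero fun j _ => (hJ k r j).integral_eq_zero (hpre j)
  have hGJ : IsGaussianProcess (fun p : ℕ × R × Fin nw => J p.1 p.2.1 p.2.2) P :=
    hW.isGaussianProcess_ito fun p => hJ p.1 p.2.1 p.2.2
  have hGS : IsGaussianProcess (fun p : (_ : ℕ) × R => ∑ j, J p.1 p.2 j) P := by
    refine isGaussianProcess_of_span fun Z hZ => hGJ.hasGaussianLaw_of_mem_span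
      (Submodule.span_le.2 ?_ hZ)
    rintro _ ⟨p, rfl⟩
    exact Submodule.sum_mem _ fun j _ => Submodule.subset_span ⟨(p.1, p.2, j), rfl⟩
  have hG : IsGaussianProcess (fun (p : (_ : ℕ) × R) ω => w p.1 ω p.2) P :=
    hGS.congr fun p => (hw' p.1 p.2).symm
  have hcross : ∀ k l r s j j', j ≠ j' → ∫ ω, J k r j ω * J l s j' ω ∂P = 0 :=
    fun k l r s j j' hjj' => (hJ k r j).integral_mul_of_indepFun (hpre j) (hpre j')
      (hW.indep.indepFun hjj') (hJ l s j')
  -- Distinct components of `W` contribute nothing, by independence; equal ones contribute through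
  -- the isometry.
  have hcov : ∀ k l r s, cov[fun ω => w k ω r, fun ω => w l ω s; P] =
      ∑ j, ∫ x, (Set.Ioc (t k) (t (k + 1))).indicator (fun x => F k x r j) x *
        (Set.Ioc (t l) (t (l + 1))).indicator (fun x => F l x s j) x := fun k l r s => by
    rw [covariance_eq_sub ((memLp_congr_ae (hw' k r)).2 (hSmem k r))
      ((memLp_congr_ae (hw' l s)).2 (hSmem l s)), integral_congr_ae (hw' k r), hmean, zero_mul,
      sub_zero, integral_congr_ae ((hw' k r).mul (hw' l s))]
    simp only [Pi.mul_apply, Finset.sum_apply, Finset.sum_mul_sum]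
    have hi : ∀ j j', Integrable (fun ω => J k r j ω * J l s j' ω) P := fun j j' =>
      (hJmem k r j).integrable_mul (hJmem l s j')
    rw [integral_finsetSum _ fun j _ => integrable_finsetSum _ fun j' _ => hi j j']
    refine Finset.sum_congr rfl fun j _ => ?_
    rw [integral_finsetSum _ fun j' _ => hi j j', Finset.sum_eq_single j]
    · exact (hJ k r j).integral_mul (hpre j) (htk k) (htk l) (hJ l s j)
    · exact fun j' _ hj' => hcross k l r s j j' hj'.symm
    · simp
  have hdiag : ∀ k r s, cov[fun ω => w k ω r, fun ω => w k ω s; P] = Q r s := fun k r s => by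
    rw [hcov, ← hQ k r s]
    refine Finset.sum_congr rfl fun j _ => ?_
    simp_rw [← Set.inter_indicator_mul, Set.inter_self]
    rw [integral_indicator measurableSet_Ioc, intervalIntegral.integral_of_le (ht k.le_succ)]
  have hoff : ∀ k l, k ≠ l → ∀ r s, cov[fun ω => w k ω r, fun ω => w l ω s; P] = 0 :=
    fun k l hkl r s => by
      rw [hcov]
      refine Finset.sum_eq_zero fun j _ => ?_
      have hd : Set.Ioc (t k) (t (k + 1)) ∩ Set.Ioc (t l) (t (l + 1)) = ∅ :=
        (ht.pairwise_disjoint_on_Ioc_succ hkl).inter_eq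
      simp_rw [← Set.inter_indicator_mul, hd]
      simp
  -- In a jointly Gaussian family, vanishing covariances between the vectors give their mutual
  -- independence.
  refine ⟨hG.iIndepFun_of_covariance_eq_zero (X := fun k r ω => w k ω r)
    (fun k r => hG.aemeasurable ⟨k, r⟩) hoff, fun k => ⟨?_, hdiag k⟩⟩
  refine hasLaw_multivariateGaussian (X := fun r ω => w k ω r) ?_ (fun r => ?_) (hdiag k)
  · refine hasGaussianLaw_pi_of_span fun Z hZ => hG.hasGaussianLaw_of_mem_span
      (Submodule.span_le.2 ?_ hZ)
    rintro _ ⟨r, rfl⟩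
    exact Submodule.subset_span ⟨⟨k, r⟩, rfl⟩
  · rw [integral_congr_ae (hw' k r), hmean]

end WhiteNoise

/-! ### The delayed piecewise constant input and its response -/

section HoldInput

variable {nu : ℕ}

lemma continuousWithinAt_floor_comp {E : Type*} [TopologicalSpace E] (g : ℤ → E) {T : ℝ}
    (hT : 0 < T) (c s : ℝ) :
    ContinuousWithinAt (fun s : ℝ => g ⌊(s - c) / T⌋) (Set.Ioi s) s := by
  have h1 : Tendsto (fun s : ℝ => (s - c) / T) (𝓝[>] s) (𝓝[≥] ((s - c) / T)) := by
    refine tendsto_nhdsWithin_iff.2 ⟨?_, ?_⟩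
    · exact (Continuous.tendsto (by fun_prop) s).mono_left nhdsWithin_le_nhds
    · filter_upwards [self_mem_nhdsWithin] with x hx
      exact div_le_div_of_nonneg_right (sub_le_sub_right (le_of_lt hx) c) hT.le
  have h2 := (tendsto_floor_right_pure_floor ((s - c) / T)).comp h1
  exact (tendsto_pure_nhds g _).comp h2

lemma intervalIntegrable_floor_comp (g : ℤ → ℝ) {T : ℝ} (hT : 0 < T) (c a b : ℝ) :
    IntervalIntegrable (fun s : ℝ => g ⌊(s - c) / T⌋) volume a b := by
  have hm : Measurable fun s : ℝ => g ⌊(s - c) / T⌋ :=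
    (measurable_from_top (f := g)).comp (Int.measurable_floor.comp (by fun_prop))
  -- On a bounded interval the floor takes finitely many values; the sum of the corresponding norms
  -- is a crude bound.
  have hbd : ∀ x ∈ Set.uIcc a b, ‖g ⌊(x - c) / T⌋‖ ≤
      ∑ k ∈ Finset.Icc ⌊(min a b - c) / T⌋ ⌊(max a b - c) / T⌋, ‖g k‖ := fun x hx => by
    refine Finset.single_le_sum (f := fun k => ‖g k‖) (fun _ _ => norm_nonneg _)
      (Finset.mem_Icc.2 ⟨Int.floor_mono ?_, Int.floor_mono ?_⟩)
    · exact div_le_div_of_nonneg_right (sub_le_sub_right hx.1 c) hT.le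
    · exact div_le_div_of_nonneg_right (sub_le_sub_right hx.2 c) hT.le
  rw [intervalIntegrable_iff]
  refine Measure.integrableOn_of_bounded (by simp) hm.aestronglyMeasurable
    ((ae_restrict_iff' measurableSet_uIoc).2 (ae_of_all _ fun x hx =>
      hbd x (Set.uIoc_subset_uIcc hx)))

/-- With `σ ∈ [0, 1)` the relative position in the sampling interval, the floor is that of `σ + k -
m + v`: it equals `k - m` until `σ` reaches `1 - v` and `k - m + 1` from then on. -/
lemma holdInput_eq_ite (u : ℤ → Fin nu → ℝ) {t0 T τ v s : ℝ} {m k : ℕ} (hT : 0 < T)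
    (hv : 0 ≤ v ∧ v < 1) (hτ : τ / T = m - v)
    (hs : s ∈ Set.Ico (t0 + k * T) (t0 + k * T + T)) :
    holdInput t0 T u (s - τ) =
      if s < t0 + k * T + (1 - v) * T then u (k - m) else u (k - m + 1) := by
  have e : (s - τ - t0) / T = (s - (t0 + k * T)) / T + k - m + v := by
    have h1 : τ = (m - v) * T := by rw [← hτ]; field_simp
    rw [h1]
    field_simp
    ring
  have h1 : 0 ≤ (s - (t0 + k * T)) / T := div_nonneg (sub_nonneg.2 hs.1) hT.le
  have h2 : (s - (t0 + k * T)) / T < 1 := by rw [div_lt_one hT]; linarith [hs.2]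
  rw [holdInput, e]
  split_ifs with h
  · congr 1
    have h3 : (s - (t0 + k * T)) / T < 1 - v := by rw [div_lt_iff₀ hT]; linarith
    rw [Int.floor_eq_iff]
    push_cast
    exact ⟨by linarith [hv.1], by linarith⟩
  · congr 1
    have h3 : 1 - v ≤ (s - (t0 + k * T)) / T := by rw [le_div_iff₀ hT]; linarith [not_lt.1 h]
    rw [Int.floor_eq_iff]
    push_cast
    exact ⟨by linarith, by linarith [hv.2]⟩

lemma holdInput_sample (u : ℤ → Fin nu → ℝ) {t0 T τ v : ℝ} {m k : ℕ} (hT : 0 < T)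
    (hv : 0 ≤ v ∧ v < 1) (hτ : τ / T = m - v) :
    holdInput t0 T u (t0 + k * T - τ) = u (k - m) := by
  rw [holdInput_eq_ite u hT hv hτ ⟨le_rfl, by linarith⟩, if_pos]
  have : 0 < (1 - v) * T := mul_pos (by linarith [hv.2]) hT
  linarith

end HoldInput

section InputIntegral

variable {R : Type*} [Fintype R] [DecidableEq R]

lemma integral_exp_sub_smul_mulVec (H : Matrix R R ℝ) (a b : ℝ) (p : R → ℝ) (i : R) :
    ∫ s in a..b, (NormedSpace.exp ((b - s) • H) *ᵥ p) i = (integralExp H (b - a) *ᵥ p) i := by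
  rw [intervalIntegral.integral_comp_sub_left (fun s => (NormedSpace.exp (s • H) *ᵥ p) i) b,
    sub_self]
  have := integral_exp_smul_mul_apply H (Matrix.of fun (r : R) (_ : Unit) => p r) (b - a) i ()
  simpa [Matrix.mulVec, dotProduct, Matrix.mul_apply] using this

/-- The substitution `s ↦ v s`, valid also for `v = 0`. It is the origin of the generator `V A_c`
and of the factor `V` in `B_2`. -/
lemma integralExp_mul (H : Matrix R R ℝ) (v T : ℝ) :
    integralExp H (v * T) = v • integralExp (v • H) T := by
  ext i j
  have := intervalIntegral.mul_integral_comp_mul_left (a := 0) (b := T)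
    (f := fun s => NormedSpace.exp (s • H) i j) (c := v)
  simp only [mul_zero] at this
  simp only [integralExp, Matrix.of_apply, Matrix.smul_apply, smul_eq_mul, smul_smul]
  rw [← this]
  simp only [mul_comm v]

lemma continuous_exp_sub_smul_mulVec (H : Matrix R R ℝ) (b : ℝ) (p : R → ℝ) (i : R) :
    Continuous fun s : ℝ => (NormedSpace.exp ((b - s) • H) *ᵥ p) i := by
  simp only [Matrix.mulVec, dotProduct]
  exact continuous_finsetSum _ fun j _ => ((continuous_exp_smul_apply H i j).comp
    (continuous_const.sub continuous_id)).mul continuous_const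

/-- The response to an input that switches from `p` to `q` at the time `v T` before the end. -/
lemma integral_exp_sub_smul_mulVec_switch (H : Matrix R R ℝ) {a T v : ℝ} (hT : 0 < T)
    (hv : 0 ≤ v ∧ v < 1) (p q : R → ℝ) {h : ℝ → R → ℝ}
    (hh : ∀ s ∈ Set.Ico a (a + T), h s = if s < a + (1 - v) * T then p else q) (i : R) :
    ∫ s in a..a + T, (NormedSpace.exp ((a + T - s) • H) *ᵥ h s) i =
      (integralExp H T *ᵥ p) i + v * (integralExp (v • H) T *ᵥ (q - p)) i := by
  set c := a + (1 - v) * T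
  have hac : a ≤ c := by
    have : 0 ≤ (1 - v) * T := mul_nonneg (by linarith [hv.2]) hT.le
    simp only [c]
    linarith
  have hcb : c ≤ a + T := by
    have : 0 ≤ v * T := mul_nonneg hv.1 hT.le
    simp only [c]
    linarith
  have hI : ∀ (x : R → ℝ) (α β : ℝ), IntervalIntegrable
      (fun s => (NormedSpace.exp ((a + T - s) • H) *ᵥ x) i) volume α β := fun x α β =>
    (continuous_exp_sub_smul_mulVec H (a + T) x i).intervalIntegrable _ _
  have e1 : Set.EqOn (fun s => (NormedSpace.exp ((a + T - s) • H) *ᵥ p) i)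
      (fun s => (NormedSpace.exp ((a + T - s) • H) *ᵥ h s) i) (Set.Ioo a c) := fun s hs => by
    dsimp only
    rw [hh s ⟨hs.1.le, hs.2.trans_le hcb⟩, if_pos hs.2]
  have e2 : Set.EqOn (fun s => (NormedSpace.exp ((a + T - s) • H) *ᵥ q) i)
      (fun s => (NormedSpace.exp ((a + T - s) • H) *ᵥ h s) i) (Set.Ioo c (a + T)) := fun s hs => by
    dsimp only
    rw [hh s ⟨hac.trans hs.1.le, hs.2⟩, if_neg (not_lt.2 hs.1.le)]
  have i1 := (hI p a c).congr_uIoo (by rwa [Set.uIoo_of_le hac])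
  have i2 := (hI q c (a + T)).congr_uIoo (by rwa [Set.uIoo_of_le hcb])
  have j1 := intervalIntegral.integral_congr_Ioo_of_le (μ := volume) hac e1
  have j2 := intervalIntegral.integral_congr_Ioo_of_le (μ := volume) hcb e2
  rw [← intervalIntegral.integral_add_adjacent_intervals i1 i2, ← j1, ← j2,
    integral_exp_sub_smul_mulVec H c (a + T) q]
  -- The contribution of `p` up to `c` is its contribution over the whole interval minus that over
  -- the last `v T`, so only `q - p` acts there.
  have h1 := intervalIntegral.integral_add_adjacent_intervals (hI p a c) (hI p c (a + T))
  rw [integral_exp_sub_smul_mulVec, integral_exp_sub_smul_mulVec] at h1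
  have hc' : a + T - c = v * T := by simp only [c]; ring
  rw [hc', integralExp_mul, add_sub_cancel_left] at h1
  rw [hc', integralExp_mul, eq_sub_of_add_eq h1]
  simp only [Matrix.smul_mulVec, Matrix.mulVec_sub, Pi.smul_apply, Pi.sub_apply, smul_eq_mul]
  ring

end InputIntegral

/-! ### Stacked inputs and the augmented state -/

section Selection

variable {ι : Type*} {n : ι → ℕ} {nu nz nw : ℕ}

/-- `ũ_k = [u_{k-M}; …; u_k]`. -/
def stackedInput (M : ℕ) (u : ℤ → Fin nu → ℝ) (k : ℤ) : InputIdx M nu → ℝ :=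
  fun q => u (k - M + (q.1 : ℕ)) q.2

lemma mulVec_stackedInput {R : Type*} {M : ℕ} (H : Matrix R (InputIdx M nu) ℝ)
    (u : ℤ → Fin nu → ℝ) (k : ℤ) :
    H *ᵥ stackedInput M u k = histCols H *ᵥ inputHistory M u k + lastCols H *ᵥ u k := by
  ext r
  simp only [Matrix.mulVec, dotProduct, Pi.add_apply, Fintype.sum_prod_type, Fin.sum_univ_castSucc,
    histCols, lastCols, Matrix.of_apply, inputHistory, stackedInput, Fin.val_castSucc, Fin.val_last]
  simp

lemma selector_mulVec {M : ℕ} (u : ℤ → Fin nu → ℝ) (k : ℤ) {p : ℕ} (hp : 1 ≤ p) (hp' : p ≤ M + 1) :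
    selector M nu p *ᵥ stackedInput M u k = u (k - M - 1 + p) := by
  ext j
  simp only [Matrix.mulVec, dotProduct, selector, Matrix.of_apply, stackedInput]
  rw [Finset.sum_eq_single ((⟨p - 1, by omega⟩ : Fin (M + 1)), j)]
  · have h1 : p - 1 + 1 = p := by omega
    simp only [h1, and_self, if_true, one_mul]
    congr 1
    push_cast [Nat.cast_sub hp]
    ring_nf
  · rintro ⟨q, j'⟩ _ hq
    rw [if_neg, zero_mul]
    rintro ⟨h1, h2⟩
    refine hq (Prod.ext (Fin.ext ?_) h2)
    simp only at h1 ⊢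
    omega
  · simp

lemma B1c_mulVec (S : System n nu nz nw) {M : ℕ} {m : ι → ℕ} (hm : ∀ b, m b ≤ M)
    (u : ℤ → Fin nu → ℝ) (k : ℤ) (r : StateIdx n) :
    (S.B1c M m *ᵥ stackedInput M u k) r = (S.B r.1 *ᵥ u (k - m r.1)) r.2 := by
  have h1 : (S.B1c M m *ᵥ stackedInput M u k) r =
      ((S.B r.1 * selector M nu (M + 1 - m r.1)) *ᵥ stackedInput M u k) r.2 := rfl
  have hm' := hm r.1
  have h2 : k - M - 1 + ((M + 1 - m r.1 : ℕ) : ℤ) = k - m r.1 := by omega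
  rw [h1, ← Matrix.mulVec_mulVec, selector_mulVec u k (by omega) (by omega), h2]

/-- For `m b = 0` the selector index would be `M + 2`, beyond the stacked input: that block is zero
and does not produce `u_{k+1}`. -/
lemma B2c_mulVec (S : System n nu nz nw) {M : ℕ} {m : ι → ℕ} (hm : ∀ b, m b ≤ M)
    (u : ℤ → Fin nu → ℝ) (k : ℤ) (r : StateIdx n) (hr : m r.1 ≠ 0) :
    (S.B2c M m *ᵥ stackedInput M u k) r = (S.B r.1 *ᵥ u (k - m r.1 + 1)) r.2 := by
  have h1 : (S.B2c M m *ᵥ stackedInput M u k) r =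
      ((S.B r.1 * selector M nu (M + 2 - m r.1)) *ᵥ stackedInput M u k) r.2 := rfl
  have hm' := hm r.1
  have h2 : k - M - 1 + ((M + 2 - m r.1 : ℕ) : ℤ) = k - m r.1 + 1 := by omega
  rw [h1, ← Matrix.mulVec_mulVec, selector_mulVec u k (by omega) (by omega), h2]

lemma Do_mulVec [Fintype ι] (S : System n nu nz nw) {M : ℕ} {m : ι → ℕ} (hm : ∀ b, m b ≤ M)
    (u : ℤ → Fin nu → ℝ) (k : ℤ) :
    S.Do M m *ᵥ stackedInput M u k = ∑ b, S.D b *ᵥ u (k - m b) := by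
  rw [System.Do, Matrix.sum_mulVec]
  refine Finset.sum_congr rfl fun b _ => ?_
  have hm' := hm b
  rw [← Matrix.mulVec_mulVec, selector_mulVec u k (by omega) (by omega)]
  congr 2
  omega

lemma shift_mulVec {M : ℕ} (u : ℤ → Fin nu → ℝ) (k : ℤ) :
    shiftA M nu *ᵥ inputHistory M u k + shiftB M nu *ᵥ u k = inputHistory M u (k + 1) := by
  ext ⟨q, j⟩
  simp only [Matrix.mulVec, dotProduct, Pi.add_apply, shiftA, shiftB, Matrix.of_apply,
    inputHistory, ite_mul, one_mul, zero_mul]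
  -- The newest slot receives `u k` through `shiftB`; every other slot copies its successor through
  -- `shiftA`.
  by_cases hq : (q : ℕ) + 1 = M
  · rw [Finset.sum_eq_zero, zero_add, Finset.sum_eq_single j]
    · rw [if_pos ⟨hq, rfl⟩]
      congr 1
      omega
    · exact fun j' _ hj' => if_neg fun h => hj' h.2.symm
    · simp
    · rintro ⟨q', j'⟩ _
      refine if_neg fun h => ?_
      have := q'.2
      have h1 := h.1
      simp only at h1
      omega
  · have hq' : (q : ℕ) + 1 < M := by have := q.2; omega
    rw [Finset.sum_eq_single ((⟨(q : ℕ) + 1, hq'⟩ : Fin M), j)]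
    · rw [if_pos ⟨rfl, rfl⟩, Finset.sum_eq_zero fun j' _ => if_neg fun h => hq h.1, add_zero]
      congr 1
      push_cast
      ring_nf
    · rintro ⟨q', j'⟩ _ hne
      refine if_neg fun h => hne (Prod.ext (Fin.ext h.1) h.2)
    · simp

/-- The augmented model is the state equation `x_{k+1} = A x_k + B_o ũ_k` together with the shift
of the past inputs. -/
lemma augmented_step [Fintype ι] {M : ℕ} (A : Matrix (StateIdx n) (StateIdx n) ℝ)
    (Bo : Matrix (StateIdx n) (InputIdx M nu) ℝ) (u : ℤ → Fin nu → ℝ) (k : ℤ)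
    (x : StateIdx n → ℝ) :
    augA A Bo *ᵥ Sum.elim x (inputHistory M u k) + augB Bo *ᵥ u k =
      Sum.elim (A *ᵥ x + Bo *ᵥ stackedInput M u k) (inputHistory M u (k + 1)) := by
  rw [augA, augB, Matrix.fromBlocks_mulVec, Matrix.fromRows_mulVec, mulVec_stackedInput,
    ← shift_mulVec]
  simp only [Sum.elim_comp_inl, Sum.elim_comp_inr, Matrix.zero_mulVec, zero_add]
  rw [← Sum.elim_add_add, add_assoc]

lemma output_eq [Fintype ι] (S : System n nu nz nw) {t0 Ts : ℝ} (hTs : 0 < Ts) {m : ι → ℕ} {v : ι → ℝ}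
    (hv : ∀ b, 0 ≤ v b ∧ v b < 1) (hmv : ∀ b, S.τ b / Ts = m b - v b) {M : ℕ}
    (hm : ∀ b, m b ≤ M) (u : ℤ → Fin nu → ℝ) (k : ℕ) (x : StateIdx n → ℝ) :
    S.output (holdInput t0 Ts u) (t0 + k * Ts) x =
      S.augC M m *ᵥ Sum.elim x (inputHistory M u k) + S.augD M m *ᵥ u k := by
  rw [System.augC, Matrix.fromCols_mulVec, Sum.elim_comp_inl, Sum.elim_comp_inr, add_assoc,
    System.augD, ← mulVec_stackedInput, Do_mulVec S hm, System.output, Finset.sum_add_distrib]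
  congr 1
  · ext i
    simp [Matrix.mulVec, dotProduct, Fintype.sum_sigma]
  · refine Finset.sum_congr rfl fun b _ => ?_
    rw [holdInput_sample u hTs (hv b) (hmv b)]

end Selection

/-! ### Sampling a path with an additive disturbance -/

section SampledPath

variable {ι : Type*} {n : ι → ℕ} {nu nz nw : ℕ}

lemma blockDiagonal'_mulVec_apply [DecidableEq ι] [Fintype ι]
    (X : ∀ b, Matrix (Fin (n b)) (Fin (n b)) ℝ)
    (y : StateIdx n → ℝ) (b : ι) (i : Fin (n b)) :
    (Matrix.blockDiagonal' X *ᵥ y) ⟨b, i⟩ = (X b *ᵥ fun j => y ⟨b, j⟩) i := by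
  simp only [Matrix.mulVec, dotProduct, Fintype.sum_sigma]
  rw [Finset.sum_eq_single b]
  · simp
  · intro b' _ hb'
    exact Finset.sum_eq_zero fun j _ => by
      rw [Matrix.blockDiagonal'_apply_ne _ _ _ hb'.symm, zero_mul]
  · simp

/-- The term `B_c u(t - τ)` of the drift. -/
def System.delayedInput (S : System n nu nz nw) (u : ℝ → Fin nu → ℝ) (t : ℝ) :
    StateIdx n → ℝ :=
  fun r => (S.B r.1 *ᵥ u (t - S.τ r.1)) r.2

variable {S : System n nu nz nw} {t0 Ts : ℝ} {u : ℤ → Fin nu → ℝ}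

lemma delayedInput_apply (s : ℝ) (r : StateIdx n) :
    S.delayedInput (holdInput t0 Ts u) s r =
      (fun k : ℤ => (S.B r.1 *ᵥ u k) r.2) ⌊(s - (S.τ r.1 + t0)) / Ts⌋ := by
  simp only [System.delayedInput, holdInput, sub_sub]

lemma intervalIntegrable_delayedInput (hTs : 0 < Ts) (r : StateIdx n) (a b : ℝ) :
    IntervalIntegrable (fun s => S.delayedInput (holdInput t0 Ts u) s r) volume a b := by
  simp_rw [delayedInput_apply]
  exact intervalIntegrable_floor_comp (fun k : ℤ => (S.B r.1 *ᵥ u k) r.2) hTs _ _ _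

lemma continuousWithinAt_delayedInput (hTs : 0 < Ts) (r : StateIdx n) (s : ℝ) :
    ContinuousWithinAt (fun s => S.delayedInput (holdInput t0 Ts u) s r) (Set.Ioi s) s := by
  simp_rw [delayedInput_apply]
  exact continuousWithinAt_floor_comp (fun k : ℤ => (S.B r.1 *ᵥ u k) r.2) hTs _ _

variable [DecidableEq ι] [Fintype ι]

/-- The response of the state to the piecewise constant input over one sampling interval. -/
lemma integral_delayedInput (hTs : 0 < Ts) {m : ι → ℕ} {v : ι → ℝ}
    (hv : ∀ b, 0 ≤ v b ∧ v b < 1) (hτ : ∀ b, 0 ≤ S.τ b) (hmv : ∀ b, S.τ b / Ts = m b - v b)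
    {M : ℕ} (hm : ∀ b, m b ≤ M) (k : ℕ) (r : StateIdx n) :
    ∫ s in t0 + k * Ts..t0 + k * Ts + Ts,
      (NormedSpace.exp ((t0 + k * Ts + Ts - s) • S.Ac) *ᵥ
        S.delayedInput (holdInput t0 Ts u) s) r =
      (S.detBo M m v Ts *ᵥ stackedInput M u k) r := by
  obtain ⟨b, i⟩ := r
  -- Delays differ between blocks, so the switching argument is applied to one block at a time.
  simp only [System.Ac, exp_smul_blockDiagonal', blockDiagonal'_mulVec_apply]
  rw [integral_exp_sub_smul_mulVec_switch (S.A b) hTs (hv b) (S.B b *ᵥ u (k - m b))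
    (S.B b *ᵥ u (k - m b + 1)) (fun s hs => ?_) i]
  · have h1 : (fun j => (S.B1c M m *ᵥ stackedInput M u k) ⟨b, j⟩) = S.B b *ᵥ u (k - m b) :=
      funext fun j => B1c_mulVec S hm u k ⟨b, j⟩
    rw [System.detBo, System.delayV_mul_Ac, System.Ac, integralExp_blockDiagonal',
      integralExp_blockDiagonal', delayV, Matrix.add_mulVec, Pi.add_apply, Matrix.mul_assoc,
      ← Matrix.mulVec_mulVec, ← Matrix.mulVec_mulVec, ← Matrix.mulVec_mulVec,
      Matrix.mulVec_diagonal, blockDiagonal'_mulVec_apply, blockDiagonal'_mulVec_apply, h1]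
    congr 1
    -- If `m b = 0`, nonnegativity of the delay forces `v b = 0`, and the term with the unavailable
    -- `u_{k+1}` disappears.
    by_cases h0 : m b = 0
    · have h2 : v b = 0 := by
        have h3 := hmv b
        have h4 := div_nonneg (hτ b) hTs.le
        rw [h3, h0] at h4
        have h5 := (hv b).1
        push_cast at h4
        linarith
      simp [h2]
    · have h2 : (fun j => ((S.B2c M m - S.B1c M m) *ᵥ stackedInput M u k) ⟨b, j⟩) =
          S.B b *ᵥ u (k - m b + 1) - S.B b *ᵥ u (k - m b) := by
        rw [← h1]
        ext j
        rw [Matrix.sub_mulVec, Pi.sub_apply, Pi.sub_apply, B2c_mulVec S hm u k ⟨b, j⟩ h0]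
      rw [h2]
  · ext j
    simp only [System.delayedInput]
    rw [holdInput_eq_ite u hTs (hv b) (hmv b) hs]
    split_ifs <;> rfl

variable {g x : ℝ → StateIdx n → ℝ}

lemma drift_eq (w : ℝ → Fin nu → ℝ) (t : ℝ) (y : StateIdx n → ℝ) :
    S.drift w t y = S.Ac *ᵥ y + S.delayedInput w t := rfl

lemma System.IsPath.intervalIntegrable_drift (hx : S.IsPath t0 (holdInput t0 Ts u) g x)
    (hTs : 0 < Ts) {a b : ℝ} (ha : t0 ≤ a) (hb : t0 ≤ b) (i : StateIdx n) :
    IntervalIntegrable (fun s => S.drift (holdInput t0 Ts u) s (x s) i) volume a b := by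
  simp only [drift_eq, Pi.add_apply]
  refine IntervalIntegrable.add (ContinuousOn.intervalIntegrable ?_)
    (intervalIntegrable_delayedInput hTs i a b)
  have hx' : ContinuousOn x (Set.uIcc a b) := hx.1.mono fun s hs => (le_min ha hb).trans hs.1
  simp only [Matrix.mulVec, dotProduct]
  exact continuousOn_finsetSum _ fun j _ => continuousOn_const.mul
    ((continuous_apply j).comp_continuousOn hx')

lemma System.IsPath.eq_add_integral (hx : S.IsPath t0 (holdInput t0 Ts u) g x) (hTs : 0 < Ts)
    {a t : ℝ} (ha : t0 ≤ a) (hat : t0 ≤ t) (i : StateIdx n) :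
    x t i = x a i + (∫ s in a..t, S.drift (holdInput t0 Ts u) s (x s) i) + (g t i - g a i) := by
  have h : ∀ b, t0 ≤ b → x b i = x t0 i +
      (∫ s in t0..b, S.drift (holdInput t0 Ts u) s (x s) i) + (g b i - g t0 i) := fun b hb => by
    have hint : IntervalIntegrable (fun s => S.drift (holdInput t0 Ts u) s (x s)) volume t0 b := by
      rw [intervalIntegrable_iff]
      exact Integrable.of_eval fun j =>
        (intervalIntegrable_iff.1 (hx.intervalIntegrable_drift hTs le_rfl hb j))
    have h1 := (ContinuousLinearMap.proj (R := ℝ) (φ := fun _ : StateIdx n => ℝ)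
      i).intervalIntegral_comp_comm hint
    simp only [ContinuousLinearMap.proj_apply] at h1
    rw [h1]
    exact congrFun (hx.2 b hb) i
  have h2 := intervalIntegral.integral_add_adjacent_intervals
    (hx.intervalIntegrable_drift hTs le_rfl ha i) (hx.intervalIntegrable_drift hTs ha hat i)
  rw [h t hat, h a ha, ← h2]
  ring

/-- The state at the next sampling instant, for an arbitrary continuous disturbance `g`. -/
theorem System.IsPath.sample (hx : S.IsPath t0 (holdInput t0 Ts u) g x) (hTs : 0 < Ts)
    (hg : ContinuousOn g (Set.Ici t0)) {m : ι → ℕ} {v : ι → ℝ}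
    (hv : ∀ b, 0 ≤ v b ∧ v b < 1) (hτ : ∀ b, 0 ≤ S.τ b) (hmv : ∀ b, S.τ b / Ts = m b - v b)
    {M : ℕ} (hm : ∀ b, m b ≤ M) (k : ℕ) (i : StateIdx n) {a b : ℝ} (ha : a = t0 + k * Ts)
    (hb : b = a + Ts) :
    x b i = (S.detA Ts *ᵥ x a) i + (S.detBo M m v Ts *ᵥ stackedInput M u k) i +
      ((g b i - g a i) + ∫ s in a..b,
        (NormedSpace.exp ((b - s) • S.Ac) *ᵥ (S.Ac *ᵥ (g s - g a))) i) := by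
  have hta : t0 ≤ a := by
    rw [ha]
    have : 0 ≤ (k : ℝ) * Ts := by positivity
    linarith
  have hab : a ≤ b := by linarith
  have hIcc : Set.Icc a b ⊆ Set.Ici t0 := fun s hs => hta.trans hs.1
  have hgc : ∀ j, ContinuousOn (fun s => g s j - g a j) (Set.Icc a b) := fun j =>
    ((continuous_apply j).comp_continuousOn (hg.mono hIcc)).sub continuousOn_const
  have hAg : ∀ j, ContinuousOn (fun s => (S.Ac *ᵥ (g s - g a)) j) (Set.Icc a b) := fun j => by
    simp only [Matrix.mulVec, dotProduct, Pi.sub_apply]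
    exact continuousOn_finsetSum _ fun l _ => continuousOn_const.mul (hgc l)
  -- Subtracting `g - g a` removes the part of `x` that need not be differentiable; `A_c (g - g a)`
  -- appears as forcing in return.
  have key := variation_of_constants S.Ac hab (z := fun s => x s - (g s - g a))
    (h := fun s => S.Ac *ᵥ (g s - g a) + S.delayedInput (holdInput t0 Ts u) s) ?_ ?_ ?_ i
  · have hsplit : ∫ s in a..b, (NormedSpace.exp ((b - s) • S.Ac) *ᵥ
        (S.Ac *ᵥ (g s - g a) + S.delayedInput (holdInput t0 Ts u) s)) i =
        (∫ s in a..b, (NormedSpace.exp ((b - s) • S.Ac) *ᵥ (S.Ac *ᵥ (g s - g a))) i) +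
        ∫ s in a..b, (NormedSpace.exp ((b - s) • S.Ac) *ᵥ
          S.delayedInput (holdInput t0 Ts u) s) i := by
      have hE : ∀ j, Continuous fun s : ℝ => NormedSpace.exp ((b - s) • S.Ac) i j := fun j =>
        (continuous_exp_smul_apply S.Ac i j).comp (continuous_const.sub continuous_id)
      simp only [Matrix.mulVec_add, Pi.add_apply]
      refine intervalIntegral.integral_add ?_ ?_
      · refine ContinuousOn.intervalIntegrable ?_
        rw [Set.uIcc_of_le hab]
        simp only [Matrix.mulVec, dotProduct] at hAg ⊢
        exact continuousOn_finsetSum _ fun j _ => (hE j).continuousOn.mul (hAg j)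
      · have e : (fun s => (NormedSpace.exp ((b - s) • S.Ac) *ᵥ
            S.delayedInput (holdInput t0 Ts u) s) i) =
            ∑ j, fun s => NormedSpace.exp ((b - s) • S.Ac) i j *
              S.delayedInput (holdInput t0 Ts u) s j := by
          funext s
          simp [Matrix.mulVec, dotProduct]
        rw [e]
        exact IntervalIntegrable.sum _ fun j _ =>
          (intervalIntegrable_delayedInput hTs j a b).continuousOn_mul (hE j).continuousOn
    rw [hsplit] at key
    have hin := integral_delayedInput (S := S) (t0 := t0) (u := u) hTs hv hτ hmv hm k i
    rw [← ha, ← hb] at hin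
    have hT : b - a = Ts := by linarith
    rw [hin, hT] at key
    simp only [Pi.sub_apply, sub_self, sub_zero] at key
    rw [System.detA]
    linarith
  · exact (hx.1.mono hIcc).sub ((hg.mono hIcc).sub continuousOn_const)
  · intro t ht j
    have h1 : ∀ s ∈ Set.Ici a, x s j - (g s j - g a j) =
        x a j + ∫ σ in a..s, S.drift (holdInput t0 Ts u) σ (x σ) j := fun s hs => by
      have := hx.eq_add_integral hTs hta (hta.trans hs) j
      linarith
    -- The drift is continuous from the right even where the input switches, so the right derivative
    -- exists at every interior time.
    have hcont : ContinuousWithinAt (fun s => S.drift (holdInput t0 Ts u) s (x s) j)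
        (Set.Ioi t) t := by
      simp only [drift_eq, Pi.add_apply]
      refine ContinuousWithinAt.add ?_ (continuousWithinAt_delayedInput hTs j t)
      simp only [Matrix.mulVec, dotProduct]
      have hxt : ContinuousWithinAt x (Set.Ioi t) t :=
        (hx.1 t (hta.trans ht.1.le)).mono fun s hs => hta.trans (ht.1.le.trans (le_of_lt hs))
      exact tendsto_finsetSum _ fun l _ => tendsto_const_nhds.mul
        (((continuous_apply l).tendsto _).comp hxt)
    have hmeas : StronglyMeasurableAtFilter (fun s => S.drift (holdInput t0 Ts u) s (x s) j)
        (𝓝[>] t) volume :=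
      ⟨Set.Ioc t b, Ioc_mem_nhdsGT ht.2, ((intervalIntegrable_iff_integrableOn_Ioc_of_le
        ht.2.le).1 (hx.intervalIntegrable_drift hTs (hta.trans ht.1.le)
          (hta.trans hab) j)).aestronglyMeasurable⟩
    have h2 := intervalIntegral.integral_hasDerivWithinAt_right
      (hx.intervalIntegrable_drift hTs hta (hta.trans ht.1.le) j) (s := Set.Ici t) hmeas hcont
    have h3 := (h2.mono Set.Ioi_subset_Ici_self).const_add (x a j)
    refine (h3.congr_deriv ?_).congr (fun s hs => h1 s (ht.1.le.trans (le_of_lt hs)))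
      (h1 t ht.1.le)
    simp only [drift_eq, Pi.add_apply, Matrix.mulVec_sub, Pi.sub_apply]
    ring
  · intro j
    simp only [Pi.add_apply]
    refine IntervalIntegrable.add (ContinuousOn.intervalIntegrable ?_)
      (intervalIntegrable_delayedInput hTs j a b)
    rw [Set.uIcc_of_le hab]
    exact hAg j

end SampledPath

/-! ### Vector Itô integrals with exponential kernels -/

section ItoVec

variable {Ω : Type*} [MeasurableSpace Ω] {P : Measure Ω} {nw : ℕ} {W : Fin nw → ℝ≥0 → Ω → ℝ}
  {R : Type*} {a b : ℝ} {F F' : ℝ → Matrix R (Fin nw) ℝ}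

/-- The value of `∫_a^b F(t) dω(t)` that integration by parts gives when `F' = dF/dt`. -/
def itoByParts (W : Fin nw → ℝ≥0 → Ω → ℝ) (a b : ℝ) (F F' : ℝ → Matrix R (Fin nw) ℝ) (ω : Ω) :
    R → ℝ :=
  fun r => ∑ j, (F b r j * (W j b.toNNReal ω - W j a.toNNReal ω) -
    ∫ s in a..b, F' s r j * (W j s.toNNReal ω - W j a.toNNReal ω))

lemma IsBrownian.isItoIntegralVec (hW : IsBrownian W P) (ha : 0 ≤ a) (hab : a ≤ b)
    (hF : ∀ r j s, HasDerivAt (fun s => F s r j) (F' s r j) s)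
    (hF' : ∀ r j, Continuous fun s => F' s r j) :
    IsItoIntegralVec W P a b F (itoByParts W a b F F') :=
  ⟨_, fun r j => isItoIntegral_of_hasDerivAt (hW.isBrownianReal j) ha hab (hF r j) (hF' r j),
    ae_of_all _ fun _ _ => rfl⟩

/-- This transfers the pathwise formula `itoByParts` to an arbitrary version of the integral. -/
lemma IsItoIntegralVec.ae_eq [Countable R] (hW : IsBrownian W P) (ha : 0 ≤ a)
    {I J : Ω → R → ℝ} (hI : IsItoIntegralVec W P a b F I) (hJ : IsItoIntegralVec W P a b F J) :
    ∀ᵐ ω ∂P, I ω = J ω := by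
  obtain ⟨K, hK, hIK⟩ := hI
  obtain ⟨L, hL, hJL⟩ := hJ
  have h : ∀ᵐ ω ∂P, ∀ r j, K r j ω = L r j ω := ae_all_iff.2 fun r => ae_all_iff.2 fun j =>
    (hK r j).ae_eq (hW.isBrownianReal j).toIsPreBrownianReal ha (hL r j)
  filter_upwards [hIK, hJL, h] with ω h1 h2 h3
  ext r
  rw [h1 r, h2 r]
  exact Finset.sum_congr rfl fun j _ => h3 r j

lemma IsItoIntegralVec.congr {G : ℝ → Matrix R (Fin nw) ℝ} {I : Ω → R → ℝ}
    (hI : IsItoIntegralVec W P a b F I) (h : ∀ s ∈ Set.Ioc a b, F s = G s) :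
    IsItoIntegralVec W P a b G I := by
  obtain ⟨K, hK, hIK⟩ := hI
  exact ⟨K, fun r j => (hK r j).congr fun s hs => by rw [h s hs], hIK⟩

end ItoVec

section ExpKernel

variable {R Q : Type*} [Fintype R] [DecidableEq R]

lemma hasDerivAt_exp_smul_mul_apply (H : Matrix R R ℝ) (K : Matrix R Q ℝ) (t : ℝ) (i : R)
    (j : Q) : HasDerivAt (fun s : ℝ => (NormedSpace.exp (s • H) * K) i j)
      ((NormedSpace.exp (t • H) * (H * K)) i j) t := by
  rw [← Matrix.mul_assoc, ← mul_exp_smul_comm]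
  simp only [Matrix.mul_apply (N := K)]
  exact HasDerivAt.fun_sum fun k _ => (hasDerivAt_exp_smul_apply H t i k).mul_const (K k j)

lemma hasDerivAt_exp_sub_smul_mul_apply (H : Matrix R R ℝ) (K : Matrix R Q ℝ) (b t : ℝ) (i : R)
    (j : Q) : HasDerivAt (fun s : ℝ => (NormedSpace.exp ((b - s) • H) * K) i j)
      ((-(NormedSpace.exp ((b - t) • H) * (H * K))) i j) t := by
  have h := (hasDerivAt_exp_smul_mul_apply H K (b - t) i j).comp t ((hasDerivAt_id t).const_sub b)
  simpa [Function.comp_def] using h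

lemma hasDerivAt_exp_smul_sub_mul_apply (H : Matrix R R ℝ) (K : Matrix R Q ℝ) (a t : ℝ) (i : R)
    (j : Q) : HasDerivAt (fun s : ℝ => (NormedSpace.exp ((s - a) • H) * K) i j)
      ((NormedSpace.exp ((t - a) • H) * (H * K)) i j) t := by
  have h := (hasDerivAt_exp_smul_mul_apply H K (t - a) i j).comp t ((hasDerivAt_id t).sub_const a)
  simpa [Function.comp_def] using h

end ExpKernel

/-! ### The sampled model and its noise -/

section Sampling

variable {ι : Type*} [DecidableEq ι] [Fintype ι] {n : ι → ℕ} {nu nz nw : ℕ}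
  {S : System n nu nz nw} {t0 Ts : ℝ} {u : ℤ → Fin nu → ℝ} {m : ι → ℕ} {v : ι → ℝ} {M : ℕ}

/-- The sampled path satisfies the augmented discrete-time model. -/
theorem System.IsPath.augmented {g x : ℝ → StateIdx n → ℝ}
    (hx : S.IsPath t0 (holdInput t0 Ts u) g x) (hTs : 0 < Ts)
    (hg : ContinuousOn g (Set.Ici t0)) (hv : ∀ b, 0 ≤ v b ∧ v b < 1) (hτ : ∀ b, 0 ≤ S.τ b)
    (hmv : ∀ b, S.τ b / Ts = m b - v b) (hm : ∀ b, m b ≤ M) (k : ℕ) {a b : ℝ}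
    (ha : a = t0 + k * Ts) (hb : b = a + Ts) {w : StateIdx n → ℝ}
    (hw : ∀ i, w i = (g b i - g a i) + ∫ s in a..b,
        (NormedSpace.exp ((b - s) • S.Ac) *ᵥ (S.Ac *ᵥ (g s - g a))) i) :
    Sum.elim (x b) (inputHistory M u (k + 1)) =
      augA (S.detA Ts) (S.detBo M m v Ts) *ᵥ Sum.elim (x a) (inputHistory M u k) +
        augB (S.detBo M m v Ts) *ᵥ u k + Sum.elim w 0 := by
  rw [augmented_step, ← Sum.elim_add_add, add_zero]
  congr 1
  ext i
  rw [hx.sample hTs hg hv hτ hmv hm k i ha hb, Pi.add_apply, Pi.add_apply, hw i]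

variable {Ω : Type*} {W : Fin nw → ℝ≥0 → Ω → ℝ}

/-- The kernel is `G` at `s = b` and its derivative is `-e^{(b-s)A_c} A_c G`. Hence integration by
parts returns exactly the disturbance term of `System.IsPath.sample` for `g = G W`. -/
lemma itoByParts_exp {a b : ℝ} {ω : Ω} (hc : ∀ j, Continuous fun t => W j t ω) (i : StateIdx n) :
    itoByParts W a b (fun s => NormedSpace.exp ((b - s) • S.Ac) * S.G)
      (fun s => -(NormedSpace.exp ((b - s) • S.Ac) * (S.Ac * S.G))) ω i =
      ((S.G *ᵥ fun j => W j b.toNNReal ω) i - (S.G *ᵥ fun j => W j a.toNNReal ω) i) +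
      ∫ s in a..b, (NormedSpace.exp ((b - s) • S.Ac) *ᵥ (S.Ac *ᵥ
        ((S.G *ᵥ fun j => W j s.toNNReal ω) - S.G *ᵥ fun j => W j a.toNNReal ω))) i := by
  have hint : ∀ j ∈ Finset.univ, IntervalIntegrable (fun s : ℝ =>
      (NormedSpace.exp ((b - s) • S.Ac) * (S.Ac * S.G)) i j *
        (W j s.toNNReal ω - W j a.toNNReal ω)) volume a b := fun j _ => by
    refine Continuous.intervalIntegrable (Continuous.mul ?_ ?_) _ _
    · exact (continuous_exp_smul_mul_apply S.Ac (S.Ac * S.G) i j).comp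
        (continuous_const.sub continuous_id)
    · exact ((hc j).comp continuous_real_toNNReal).sub continuous_const
  have e : ∀ s : ℝ, (NormedSpace.exp ((b - s) • S.Ac) *ᵥ (S.Ac *ᵥ
        ((S.G *ᵥ fun j => W j s.toNNReal ω) - S.G *ᵥ fun j => W j a.toNNReal ω))) i =
      ∑ j, (NormedSpace.exp ((b - s) • S.Ac) * (S.Ac * S.G)) i j *
        (W j s.toNNReal ω - W j a.toNNReal ω) := fun s => by
    rw [← Matrix.mulVec_sub, Matrix.mulVec_mulVec, Matrix.mulVec_mulVec, Matrix.mul_assoc]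
    rfl
  simp_rw [e]
  rw [intervalIntegral.integral_finsetSum hint]
  rw [← Pi.sub_apply, ← Matrix.mulVec_sub]
  simp only [itoByParts, sub_self, zero_smul, NormedSpace.exp_zero, Matrix.one_mul,
    Matrix.neg_apply, neg_mul, intervalIntegral.integral_neg, sub_neg_eq_add,
    Finset.sum_add_distrib, Matrix.mulVec, dotProduct, Pi.sub_apply]

end Sampling

section NoiseCovariance

variable {ι : Type*} [DecidableEq ι] [Fintype ι] {n : ι → ℕ} {nu nz nw : ℕ}
  {S : System n nu nz nw} {M : ℕ} {m : ι → ℕ} {v : ι → ℝ} {T : ℝ}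
  {A Av : ℝ → Matrix (StateIdx n) (StateIdx n) ℝ} {B1 B2 : ℝ → Matrix (StateIdx n) (InputIdx M nu) ℝ}
  {Rww : ℝ → Matrix (StateIdx n) (StateIdx n) ℝ}

lemma System.IsODESolution.Rww_eq_sum (h : S.IsODESolution M m v T A Av B1 B2 Rww) (hT : 0 ≤ T)
    (r s : StateIdx n) :
    Rww T r s = ∑ j, ∫ x in (0 : ℝ)..T, (NormedSpace.exp (x • S.Ac) * S.G) r j *
      (NormedSpace.exp (x • S.Ac) * S.G) s j := by
  rw [h.Rww_apply hT]
  simp only [Matrix.mul_apply (N := (_)ᵀ), Matrix.transpose_apply]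
  exact intervalIntegral.integral_finsetSum fun j _ => Continuous.intervalIntegrable
    ((continuous_exp_smul_mul_apply _ _ r j).mul (continuous_exp_smul_mul_apply _ _ s j)) _ _

end NoiseCovariance

end TimeDelay

end

/-! ### The main theorem -/

open TimeDelay

theorem proposition3 {ι : Type*} [Fintype ι] [DecidableEq ι] {n : ι → ℕ} {nu nz nw : ℕ}
    (S : TimeDelay.System n nu nz nw)
    -- sampling time, sampling instants `t_k = t0 + k Ts`, delays `τ_b / Ts = m_b - v_b`
    (t0 Ts : ℝ) (ht0 : 0 ≤ t0) (hTs : 0 < Ts) (hτ : ∀ b, 0 ≤ S.τ b)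
    (m : ι → ℕ) (v : ι → ℝ) (hv : ∀ b, 0 ≤ v b ∧ v b < 1) (hmv : ∀ b, S.τ b / Ts = m b - v b)
    (M : ℕ) (hM : M = Finset.univ.sup m)
    (u : ℤ → Fin nu → ℝ)
    {Ω : Type*} [MeasurableSpace Ω] (P : MeasureTheory.Measure Ω)
    [MeasureTheory.IsProbabilityMeasure P]
    (W : Fin nw → NNReal → Ω → ℝ) (hW : TimeDelay.IsBrownian W P) :
    -- the system of differential equations is solvable
    (∃ A Av B1 B2 Rww, S.IsODESolution M m v Ts A Av B1 B2 Rww) ∧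
    ∀ A Av B1 B2 Rww, S.IsODESolution M m v Ts A Av B1 B2 Rww →
      -- its solution gives the matrices `A` and `B_o` of the deterministic case
      (A Ts = S.detA Ts ∧ B1 Ts + B2 Ts = S.detBo M m v Ts) ∧
      (∀ y : ℝ → TimeDelay.StateIdx n → ℝ,
        S.IsDeterministicSolution t0 (TimeDelay.holdInput t0 Ts u) y → ∀ k : ℕ,
          Sum.elim (y (t0 + (k + 1) * Ts)) (TimeDelay.inputHistory M u (k + 1)) =
            TimeDelay.augA (A Ts) (B1 Ts + B2 Ts) *ᵥ
                Sum.elim (y (t0 + k * Ts)) (TimeDelay.inputHistory M u k) +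
              TimeDelay.augB (B1 Ts + B2 Ts) *ᵥ u k) ∧
      -- the process noise `w_k = ∫ A(t_{k+1} - t) G_c dω(t)` over `[t_k, t_{k+1}]` exists
      (∃ w : ℕ → Ω → TimeDelay.StateIdx n → ℝ,
        ∀ k : ℕ, TimeDelay.IsItoIntegralVec W P (t0 + k * Ts) (t0 + (k + 1) * Ts)
          (fun t => A (t0 + (k + 1) * Ts - t) * S.G) (w k)) ∧
      (∀ w : ℕ → Ω → TimeDelay.StateIdx n → ℝ,
        (∀ k : ℕ, TimeDelay.IsItoIntegralVec W P (t0 + k * Ts) (t0 + (k + 1) * Ts)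
          (fun t => A (t0 + (k + 1) * Ts - t) * S.G) (w k)) →
        -- it is Gaussian white noise with covariance `R_ww(Ts)`
        TimeDelay.IsGaussianWhiteNoise P (Rww Ts) w ∧
        -- the sampled solution of the stochastic system follows the discrete-time model
        ∀ x : ℝ → Ω → TimeDelay.StateIdx n → ℝ,
          S.IsStochasticSolution W P t0 (TimeDelay.holdInput t0 Ts u) x →
          ∀ᵐ ω ∂P, ∀ k : ℕ,
            Sum.elim (x (t0 + (k + 1) * Ts) ω) (TimeDelay.inputHistory M u (k + 1)) =
              TimeDelay.augA (A Ts) (B1 Ts + B2 Ts) *ᵥ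
                  Sum.elim (x (t0 + k * Ts) ω) (TimeDelay.inputHistory M u k) +
                TimeDelay.augB (B1 Ts + B2 Ts) *ᵥ u k +
                Sum.elim (w k ω) 0 ∧
            S.output (TimeDelay.holdInput t0 Ts u) (t0 + k * Ts) (x (t0 + k * Ts) ω) =
              S.augC M m *ᵥ Sum.elim (x (t0 + k * Ts) ω) (TimeDelay.inputHistory M u k) +
                S.augD M m *ᵥ u k) ∧
      -- the integrals of `A(t - t_k) G_c` have the same joint law
      (∃ w : ℕ → Ω → TimeDelay.StateIdx n → ℝ,
        ∀ k : ℕ, TimeDelay.IsItoIntegralVec W P (t0 + k * Ts) (t0 + (k + 1) * Ts)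
          (fun t => A (t - (t0 + k * Ts)) * S.G) (w k)) ∧
      (∀ w : ℕ → Ω → TimeDelay.StateIdx n → ℝ,
        (∀ k : ℕ, TimeDelay.IsItoIntegralVec W P (t0 + k * Ts) (t0 + (k + 1) * Ts)
          (fun t => A (t - (t0 + k * Ts)) * S.G) (w k)) →
        TimeDelay.IsGaussianWhiteNoise P (Rww Ts) w) := by
  have hm : ∀ b, m b ≤ M := fun b => hM ▸ Finset.le_sup (Finset.mem_univ b)
  have htk : ∀ k : ℕ, 0 ≤ t0 + k * Ts := fun k => by positivity
  have hle : ∀ k : ℕ, t0 + k * Ts ≤ t0 + (k + 1) * Ts := fun k => by nlinarith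
  have hstep : ∀ k : ℕ, t0 + ((k : ℝ) + 1) * Ts = t0 + k * Ts + Ts := fun k => by ring
  have hmono : Monotone fun k : ℕ => t0 + (k : ℝ) * Ts :=
    monotone_nat_of_le_succ fun k => by push_cast; exact hle k
  have hexp1 : ∀ k : ℕ, IsItoIntegralVec W P (t0 + k * Ts) (t0 + (k + 1) * Ts)
      (fun s => NormedSpace.exp ((t0 + (k + 1) * Ts - s) • S.Ac) * S.G)
      (itoByParts W _ _ _ fun s =>
        -(NormedSpace.exp ((t0 + (k + 1) * Ts - s) • S.Ac) * (S.Ac * S.G))) := fun k =>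
    hW.isItoIntegralVec (htk k) (hle k)
      (fun r j s => hasDerivAt_exp_sub_smul_mul_apply S.Ac S.G _ s r j)
      (fun r j => ((continuous_exp_smul_mul_apply S.Ac (S.Ac * S.G) r j).comp
        (continuous_const.sub continuous_id)).neg)
  have hexp2 : ∀ k : ℕ, IsItoIntegralVec W P (t0 + k * Ts) (t0 + (k + 1) * Ts)
      (fun s => NormedSpace.exp ((s - (t0 + k * Ts)) • S.Ac) * S.G)
      (itoByParts W _ _ _ fun s =>
        NormedSpace.exp ((s - (t0 + k * Ts)) • S.Ac) * (S.Ac * S.G)) := fun k =>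
    hW.isItoIntegralVec (htk k) (hle k)
      (fun r j s => hasDerivAt_exp_smul_sub_mul_apply S.Ac S.G _ s r j)
      (fun r j => (continuous_exp_smul_mul_apply S.Ac (S.Ac * S.G) r j).comp
        (continuous_id.sub continuous_const))
  refine ⟨S.exists_isODESolution M m v Ts, fun A Av B1 B2 Rww h => ?_⟩
  have hA : A Ts = S.detA Ts := h.A_eq ⟨hTs.le, le_rfl⟩
  have hBo := h.Bo_eq hTs.le
  -- `A` is known only on `[0, Ts]`; inside a sampling interval the argument stays there.
  have hA1 : ∀ k : ℕ, ∀ s ∈ Set.Ioc (t0 + k * Ts) (t0 + (k + 1) * Ts),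
      A (t0 + (k + 1) * Ts - s) * S.G =
        NormedSpace.exp ((t0 + (k + 1) * Ts - s) • S.Ac) * S.G := fun k s hs => by
    rw [h.A_eq ⟨by linarith [hs.2], by linarith [hs.1, hstep k]⟩]
  have hA2 : ∀ k : ℕ, ∀ s ∈ Set.Ioc (t0 + k * Ts) (t0 + (k + 1) * Ts),
      A (s - (t0 + k * Ts)) * S.G =
        NormedSpace.exp ((s - (t0 + k * Ts)) • S.Ac) * S.G := fun k s hs => by
    rw [h.A_eq ⟨by linarith [hs.1], by linarith [hs.2, hstep k]⟩]
  refine ⟨⟨hA, hBo⟩, fun y hy k => ?_,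
    ⟨_, fun k => (hexp1 k).congr fun s hs => (hA1 k s hs).symm⟩, fun w hw => ?_,
    ⟨_, fun k => (hexp2 k).congr fun s hs => (hA2 k s hs).symm⟩, fun w hw => ?_⟩
  · rw [hA, hBo]
    -- The deterministic case is the sampled path with zero disturbance.
    have := System.IsPath.augmented hy hTs continuousOn_const hv hτ hmv hm k rfl (hstep k) (w := 0)
      (fun i => by simp [Matrix.mulVec_zero])
    have h0 : Sum.elim (0 : StateIdx n → ℝ) (0 : Fin M × Fin nu → ℝ) = 0 := by
      ext (i | i) <;> rfl
    rw [this, h0, add_zero]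
  · have hw' := fun k => (hw k).congr (hA1 k)
    refine ⟨hW.isGaussianWhiteNoise hmono (by simpa using ht0)
      (F := fun k s => NormedSpace.exp ((t0 + (k + 1) * Ts - s) • S.Ac) * S.G)
      (fun k => by simpa only [Nat.cast_add, Nat.cast_one] using hw' k) fun k r s => ?_, ?_⟩
    · rw [h.Rww_eq_sum hTs.le]
      refine Finset.sum_congr rfl fun j _ => ?_
      -- Reflection `x ↦ t_{k+1} - x` maps the sampling interval onto `[0, Ts]`, so the covariance
      -- does not depend on `k`.
      have := intervalIntegral.integral_comp_sub_left (a := t0 + k * Ts) (b := t0 + (k + 1) * Ts)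
        (fun x => (NormedSpace.exp (x • S.Ac) * S.G) r j * (NormedSpace.exp (x • S.Ac) * S.G) s j)
        (t0 + (k + 1) * Ts)
      rw [sub_self, hstep, add_sub_cancel_left] at this
      simpa only [Nat.cast_add, Nat.cast_one, hstep] using this
    · intro x hx
      have hcont : ∀ᵐ ω ∂P, ∀ j, Continuous fun t => W j t ω :=
        ae_all_iff.2 fun j => (hW.isBrownianReal j).cont
      have hwk : ∀ᵐ ω ∂P, ∀ k, w k ω = _ :=
        ae_all_iff.2 fun k => (hw' k).ae_eq hW (htk k) (hexp1 k)
      filter_upwards [hx.2, hcont, hwk] with ω hpath hc hwω k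
      refine ⟨?_, output_eq S hTs hv hmv hm u k _⟩
      rw [hA, hBo]
      refine System.IsPath.augmented hpath hTs ?_ hv hτ hmv hm k rfl (hstep k) fun i => ?_
      · refine Continuous.continuousOn ?_
        exact continuous_const.matrix_mulVec
          (continuous_pi fun j => (hc j).comp continuous_real_toNNReal)
      · rw [hwω k, itoByParts_exp hc]
  · have hw' := fun k => (hw k).congr (hA2 k)
    refine hW.isGaussianWhiteNoise hmono (by simpa using ht0)
      (F := fun k s => NormedSpace.exp ((s - (t0 + k * Ts)) • S.Ac) * S.G)
      (fun k => by simpa only [Nat.cast_add, Nat.cast_one] using hw' k) fun k r s => ?_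
    rw [h.Rww_eq_sum hTs.le]
    refine Finset.sum_congr rfl fun j _ => ?_
    -- For this kernel a translation by `t_k` replaces the reflection and leads to the same
    -- integral.
    have := intervalIntegral.integral_comp_sub_right (a := t0 + k * Ts) (b := t0 + (k + 1) * Ts)
      (fun x => (NormedSpace.exp (x • S.Ac) * S.G) r j * (NormedSpace.exp (x • S.Ac) * S.G) s j)
      (t0 + k * Ts)
    rw [sub_self, hstep, add_sub_cancel_left] at this
    simpa only [Nat.cast_add, Nat.cast_one, hstep] using this
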